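/- Let $q$ be a prime power, $\mathbb F_q$ the field with $q$ elements, and let $B_q(n)$ be the poset of all subspaces of $\mathbb F_q^n$, ordered by inclusion and ranked by dimension. For a finite set $P$ let $V(P)$ be the complex vector space with basis $P$ and with the inner product for which $P$ is orthonormal. Let $U_n$ be the up operator on $V(B_q(n))$, which sends $X$ to $\sum_Y Y$, the sum over all $Y$ covering $X$. A symmetric Jordan chain (SJC) in $V(B_q(n))$ is a sequence $(x_k,\dots,x_{n-k})$ with $0\le k\le n/2$, where $x_u$ is a nonzero combination of $u$-dimensional subspaces, $U_n(x_u)=x_{u+1}$ for $k\le u<n-k$, and $U_n(x_{n-k})=0$. A symmetric Jordan basis (SJB) is a basis of $V(B_q(n))$ that is a disjoint union of SJCs. Put $[m]_q=1+q+\dots+q^{m-1}$. Identify $\mathbb F_q^n$ with the subspace of $\mathbb F_q^{n+1}$ of vectors with last component $0$ (so that $B_q(n)\subseteq B_q(n+1)$ and $V(B_q(n))\subseteq V(B_q(n+1))$). For $X\in B_q(n)$ let $\widehat X=X+\langle e_{n+1}\rangle\in B_q(n+1)$. Let $\theta_n:V(B_q(n))\to V(B_q(n+1))$ be the linear map that sends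 $X$ to the sum of all $Y\in B_q(n+1)$ with $Y\not\subseteq\mathbb F_q^n$ and $Y\cap\mathbb F_q^n=X$. For a character $\chi$ of the additive group $\mathbb F_q^n$ let $p(\chi)=\sum_{a\in\mathbb F_q^n}\overline{\chi(a)}\,g_a$, where $g_a$ is the operator on $V(B_q(n+1))$ induced by the linear automorphism $v\mapsto v+v_{n+1}a$ of $\mathbb F_q^{n+1}$. For $n\ge1$ and $\chi$ nontrivial let $X(\chi)$ be the unique $(n-1)$-dimensional subspace $X$ of $\mathbb F_q^n$ with $p(\chi)(\widehat X)\ne0$, let $\tau_\chi:\mathbb F_q^{n-1}\to X(\chi)$ be the isomorphism given by the $n\times(n-1)$ matrix in column reduced echelon form with column space $X(\chi)$, and let $\gamma_\chi:V(B_q(n-1))\to V(B_q(n+1))$ be the linear map $Y\mapsto p(\chi)(\widehat{\tau_\chi(Y)})$. Define collections $J_q(n)$ of sequences of vectors of $V(B_q(n))$ inductively. $J_q(0)$ consists of the one-term sequence $(\{0\})$, and $J_q(1)$ of the sequence $(\{0\},\mathbb F_q^1)$. For $n\ge1$, $J_q(n+1)$ consists of the following sequences. (a) For each $(x_k,\dots,x_{n-k})\in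 J_q(n)$, with the convention $x_{k-1}=x_{n+1-k}=0$, the sequence $(y_k,\dots,y_{n+1-k})$ with $y_l=x_l+[l-k]_q\,\theta_n(x_{l-1})$, and, if $k<n-k$, also the sequence $(z_{k+1},\dots,z_{n-k})$ with $z_l=-q^n x_l+q^{l+k-1}[n-l-k+1]_q\,\theta_n(x_{l-1})$. (b) For each $(x_k,\dots,x_{n-1-k})\in J_q(n-1)$ and each nontrivial character $\chi$ of $\mathbb F_q^n$, the sequence $(y_{k+1},\dots,y_{n-k})$ with $y_{u+1}=\gamma_\chi(x_u)$. **Theorem.** For every $n\ge0$, $J_q(n)$ is an orthogonal SJB of $V(B_q(n))$, that is, the sequences in $J_q(n)$ are SJCs and their disjoint union is an orthogonal basis of $V(B_q(n))$. In the standard basis $B_q(n)$, all coefficients of the vectors in $J_q(n)$ are integral multiples of $q$-th roots of unity; in particular they are integers if $q=2$. If $0\le k\le n/2$ and $(x_k,\dots,x_{n-k})$ is any SJC in $J_q(n)$ starting at rank $k$ and ending at rank $n-k$, then for $k\le u<n-k$ $$\frac{\|x_{u+1}\|}{\|x_u\|}=\sqrt{q^k\,[u+1-k]_q\,[n-k-u]_q}.$$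 -/

import Mathlib

namespace SubspaceLattice

noncomputable section

/-! ## The inner product space on a finite poset, the up operator, Jordan chains -/

/-- `V P` is the complex vector space with basis the finite set `P`, with the standard inner
product (for which the elements of `P` are orthonormal). The coefficient of `x` in `v` is `v x`. -/
abbrev V (P : Type*) [Fintype P] := EuclideanSpace ℂ P

/-- The element `x` of `P`, as a standard basis vector of `V P`. -/
def basisVec {P : Type*} [Fintype P] (x : P) : V P := EuclideanSpace.basisFun P ℂ x

/-- The linear map on `V P` with prescribed values on the elements of `P`. -/
def linExt {P W : Type*} [Fintype P] [AddCommGroup W] [Module ℂ W] (f : P → W) : V P →ₗ[ℂ] W :=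
  (EuclideanSpace.basisFun P ℂ).toBasis.constr ℂ f

open scoped Classical in
/-- The up operator: `x` is sent to the sum of all elements covering `x`. -/
def up (P : Type*) [Fintype P] [PartialOrder P] : V P →ₗ[ℂ] V P :=
  linExt fun x => ∑ y with x ⋖ y, basisVec y

/-- `v` is a homogeneous vector of rank `i`: only elements of rank `i` occur in it. -/
def IsHomogeneous {P : Type*} [Fintype P] (r : P → ℕ) (i : ℕ) (v : V P) : Prop :=
  ∀ x, v x ≠ 0 → r x = i

/-- A finite sequence `(x_k, …, x_e)` of vectors, indexed by the integers from `k = start` to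
`e = finish`. The values of `vec` at other indices are irrelevant. -/
structure Chain (W : Type*) where
  start : ℕ
  finish : ℕ
  vec : ℕ → W

/-- The term `x_u` of the sequence, with the convention `x_u = 0` outside the index range. -/
def Chain.get {W : Type*} [Zero W] (c : Chain W) (u : ℕ) : W :=
  if c.start ≤ u ∧ u ≤ c.finish then c.vec u else 0

/-- The set of the vectors `x_k, …, x_e`. -/
def Chain.vectors {W : Type*} (c : Chain W) : Set W := c.vec '' Set.Icc c.start c.finish

/-- Graded Jordan chains: nonzero homogeneous vectors `x_k, …, x_e`, where `x_u` has rank `u`,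
such that the up operator maps each to the next one and the last one to `0`. -/
structure IsGradedJordanChain {P : Type*} [Fintype P] [PartialOrder P] (r : P → ℕ)
    (c : Chain (V P)) : Prop where
  start_le_finish : c.start ≤ c.finish
  homogeneous : ∀ u, c.start ≤ u → u ≤ c.finish → IsHomogeneous r u (c.vec u)
  ne_zero : ∀ u, c.start ≤ u → u ≤ c.finish → c.vec u ≠ 0
  up_vec : ∀ u, c.start ≤ u → u < c.finish → up P (c.vec u) = c.vec (u + 1)
  up_finish : up P (c.vec c.finish) = 0

/-- Symmetric Jordan chains in a graded poset of rank `n`: starting and ending rank add up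
to `n`. -/
def IsSymmetricJordanChain {P : Type*} [Fintype P] [PartialOrder P] (r : P → ℕ) (n : ℕ)
    (c : Chain (V P)) : Prop :=
  IsGradedJordanChain r c ∧ c.start + c.finish = n

/-- All vectors that occur in a collection of chains. -/
def allVectors {W : Type*} (J : Set (Chain W)) : Set W := ⋃ c ∈ J, c.vectors

/-- Symmetric Jordan bases of `V P`, for a graded poset `P` of rank `n`: bases that are disjoint
unions of symmetric Jordan chains. -/
structure IsSymmetricJordanBasis {P : Type*} [Fintype P] [PartialOrder P] (r : P → ℕ) (n : ℕ)
    (J : Set (Chain (V P))) : Prop where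
  chain : ∀ c ∈ J, IsSymmetricJordanChain r n c
  disjoint : J.PairwiseDisjoint Chain.vectors
  linearIndep : LinearIndepOn ℂ id (allVectors J)
  span_eq_top : Submodule.span ℂ (allVectors J) = ⊤

/-- The vectors that occur in the chains are pairwise orthogonal. -/
def IsOrthogonalFamily {P : Type*} [Fintype P] (J : Set (Chain (V P))) : Prop :=
  (allVectors J).Pairwise fun v w => inner ℂ v w = 0

/-! ## Subspaces of `F ^ n` -/

/-- The `q`-integer `1 + q + ⋯ + q ^ (m - 1)`. -/
def qInt (q m : ℕ) : ℕ := ∑ i ∈ Finset.range m, q ^ i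

/-- The poset of all subspaces of `F ^ n`. -/
abbrev B (F : Type*) [Field F] (n : ℕ) := Submodule F (Fin n → F)

instance (F : Type*) [Field F] [Fintype F] (n : ℕ) : Fintype (B F n) := Fintype.ofFinite _

/-- The rank function of the poset of subspaces is the dimension. -/
def dim {F : Type*} [Field F] {n : ℕ} (X : B F n) : ℕ := Module.finrank F X

variable {F : Type*} [Field F]

/-- `F ^ n` as the subspace of `F ^ (n + 1)` of vectors with last component zero. -/
def incl (F : Type*) [Field F] (n : ℕ) : (Fin n → F) →ₗ[F] (Fin (n + 1) → F) where
  toFun v := Fin.snoc (α := fun _ => F) v 0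
  map_add' v w := by
    ext i
    refine Fin.lastCases ?_ (fun j => ?_) i <;> simp
  map_smul' a v := by
    ext i
    refine Fin.lastCases ?_ (fun j => ?_) i <;> simp

/-- The subspace of `F ^ (n + 1)` spanned by `X ⊆ F ^ n` and the last standard basis vector. -/
def hat {n : ℕ} (X : B F n) : B F (n + 1) :=
  X.map (incl F n) ⊔ Submodule.span F {Pi.single (Fin.last n) 1}

/-- The subspaces of `F ^ (n + 1)` that are not contained in `F ^ n`. -/
def A (F : Type*) [Field F] (n : ℕ) : Set (B F (n + 1)) :=
  {Y | ¬ Y ≤ LinearMap.range (incl F n)}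

/-- The intersection of `Y ⊆ F ^ (n + 1)` with `F ^ n`, as a subspace of `F ^ n`. -/
def hyperInter {n : ℕ} (Y : B F (n + 1)) : B F n := Y.comap (incl F n)

/-- The linear automorphism `v ↦ v + v_{n+1} a` of `F ^ (n + 1)`, for `a` in `F ^ n`. Its matrix is
the identity matrix but for the last column, which is `(a_1, …, a_n, 1)`. -/
def shear {n : ℕ} (a : Fin n → F) : (Fin (n + 1) → F) →ₗ[F] (Fin (n + 1) → F) :=
  LinearMap.id + (LinearMap.proj (Fin.last n)).smulRight (incl F n a)

/-- Schubert normal form (column reduced echelon form): the first nonzero entry of column `j` is a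
`1`, in row `r j`; the `r j` are increasing, and the rows `r j` form an identity matrix. -/
def IsSchubertNormalForm {n k : ℕ} (M : Matrix (Fin n) (Fin k) F) : Prop :=
  ∃ r : Fin k → Fin n, StrictMono r ∧ (∀ j, ∀ i < r j, M i j = 0) ∧
    ∀ j j', M (r j) j' = if j = j' then 1 else 0

open scoped Classical in
/-- The (unique) `n × k` matrix in Schubert normal form with column space `X`, where `k` is the
dimension of `X` (and `0` if `X` has another dimension). -/
def schubertMatrix {n : ℕ} (k : ℕ) (X : B F n) : Matrix (Fin n) (Fin k) F :=
  if h : ∃ M : Matrix (Fin n) (Fin k) F,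
      IsSchubertNormalForm M ∧ LinearMap.range M.mulVecLin = X
  then h.choose else 0

variable [Fintype F]

/-- The inclusion of `V (B F n)` in `V (B F (n + 1))`. -/
def inclV (F : Type*) [Field F] [Fintype F] (n : ℕ) : V (B F n) →ₗ[ℂ] V (B F (n + 1)) :=
  linExt fun X => basisVec (X.map (incl F n))

open scoped Classical in
/-- `X` is sent to the sum of all `Y` not contained in `F ^ n` whose intersection with `F ^ n` is
the same as that of `hat X`. -/
def theta (F : Type*) [Field F] [Fintype F] (n : ℕ) : V (B F n) →ₗ[ℂ] V (B F (n + 1)) :=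
  linExt fun X => ∑ Y with Y ∈ A F n ∧ hyperInter Y = hyperInter (hat X), basisVec Y

/-- For a character `χ` of `F ^ n`, identified with the group of the automorphisms `shear a`, the
operator `∑ a, conj (χ a) • shear a` on the span of the subspaces of `F ^ (n + 1)`. -/
def charSum {n : ℕ} (χ : AddChar (Fin n → F) ℂ) : V (B F (n + 1)) →ₗ[ℂ] V (B F (n + 1)) :=
  ∑ a : Fin n → F, (starRingEnd ℂ) (χ a) • linExt fun Y => basisVec (Y.map (shear a))

/-- For a nontrivial character `χ` of `F ^ (m + 1)`, the unique subspace `X` of dimension `m` such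
that `charSum χ` does not vanish at `hat X` (written as the supremum of all such `X`). -/
def charHyperplane {m : ℕ} (χ : AddChar (Fin (m + 1) → F) ℂ) : B F (m + 1) :=
  sSup {X | dim X = m ∧ charSum χ (basisVec (hat X)) ≠ 0}

/-- The map from subspaces of `F ^ m` to the isotypical component of `χ`: `F ^ m` is identified
with the hyperplane of `χ` by its matrix in Schubert normal form, and a subspace `Z` of that
hyperplane is sent to `charSum χ (hat Z)`. -/
def gamma {m : ℕ} (χ : AddChar (Fin (m + 1) → F) ℂ) : V (B F m) →ₗ[ℂ] V (B F (m + 2)) :=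
  linExt fun Y => charSum χ
    (basisVec (hat (Y.map (schubertMatrix m (charHyperplane χ)).mulVecLin)))

/-! ## The inductive construction -/

/-- From `(x_k, …, x_{n-k})`, the chain `y_l = x_l + [l-k] θ(x_{l-1})`, `k ≤ l ≤ n+1-k`. -/
def yChain {n : ℕ} (c : Chain (V (B F n))) : Chain (V (B F (n + 1))) where
  start := c.start
  finish := c.finish + 1
  vec l := inclV F n (c.get l) +
    (qInt (Fintype.card F) (l - c.start) : ℂ) • theta F n (c.get (l - 1))

/-- From `(x_k, …, x_{n-k})`, the chain
`z_l = - q^n x_l + q^(l+k-1) [n-l-k+1] θ(x_{l-1})`, `k+1 ≤ l ≤ n-k`. -/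
def zChain {n : ℕ} (c : Chain (V (B F n))) : Chain (V (B F (n + 1))) where
  start := c.start + 1
  finish := c.finish
  vec l := -((Fintype.card F : ℂ) ^ n) • inclV F n (c.get l) +
    ((Fintype.card F : ℂ) ^ (l + c.start - 1) *
      (qInt (Fintype.card F) (n - l - c.start + 1) : ℂ)) • theta F n (c.get (l - 1))

/-- From `(x_k, …, x_{m-k})`, the chain `y_{u+1} = γ(x_u)`, `k ≤ u ≤ m-k`. -/
def gammaChain {m : ℕ} (χ : AddChar (Fin (m + 1) → F) ℂ) (c : Chain (V (B F m))) :
    Chain (V (B F (m + 2))) where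
  start := c.start + 1
  finish := c.finish + 1
  vec l := gamma χ (c.get (l - 1))

/-- The inductively constructed collection of chains. Every chain of the previous step gives
a chain `y`, and also a chain `z` if it has at least two terms; every chain of the
step before gives a chain for every nontrivial character. -/
def J (F : Type*) [Field F] [Fintype F] : (n : ℕ) → Set (Chain (V (B F n)))
  | 0 => {⟨0, 0, fun _ => basisVec ⊥⟩}
  | 1 => {⟨0, 1, fun u => if u = 0 then basisVec ⊥ else basisVec ⊤⟩}
  | m + 2 =>
      yChain '' J F (m + 1) ∪ zChain '' {c ∈ J F (m + 1) | c.start < c.finish} ∪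
        ⋃ χ ∈ {χ : AddChar (Fin (m + 1) → F) ℂ | χ ≠ 1}, gammaChain χ '' J F m

end

end SubspaceLattice

/-!
The operators `shear a` act on the subspaces of `F ^ (n + 1)` and decompose the span of those not
contained in `F ^ n` into isotypical components, one for each character `χ` of `F ^ n`. Subspaces
through a point `(a, 1)` correspond to subspaces of `F ^ n`, by `X ↦ cone a X = X + ⟨(a, 1)⟩` and
`Z ↦ hyperInter Z`. Writing `affSum χ Z` for the sum of `conj (χ a)` over all `a` with `(a, 1) ∈ Z`,
the component of `χ` consists of the functions `spread χ w : Z ↦ affSum χ Z * w (hyperInter Z)`.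
Summing over pairs `(a, 1) ∈ Z` in two ways gives their inner products (`inner_spread`) and the
action of the up operator, which is that of the up operator on `w` (`up_spread`).

The map `theta` takes values in the component of the trivial character, and `gamma χ` in that of a
nontrivial `χ`. A character is trivial on a largest linear subspace, the hyperplane of `χ`
(`tau_spec`), and `affSum χ Z = 0` unless `χ` is trivial on `hyperInter Z`. So `gamma χ` commutes with
the up operator `U` (`up_gamma`) and scales inner products in rank `u` by `q ^ (n + u)`
(`inner_gamma_gamma`). Moreover `U ∘ inclV = inclV ∘ U + theta`, `U ∘ theta = q • theta ∘ U`, and `theta`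
scales inner products in rank `u` by `q ^ (n - u)` (`up_inclV`, `up_theta`, `inner_theta_theta`).

From these facts all the claims follow by induction. With `[a + b] = [a] + q ^ a [b]` the recursion
formulas yield Jordan chains; the norm formula for a chain `x` gives the orthogonality of the two
chains `y` and `z` made from it, and the norm formulas for `y` and `z`. Orthogonality of other pairs
of chains comes from that of different components. The new chains generate, as `inclV x_l` and
`theta x_{l-1}` are combinations of `y_l` and `z_l` (`mem_span_yz`), and as the images of `inclV`,
`theta` and `gamma χ` span everything, by Fourier inversion (`span_images_eq_top`). An orthogonal
family of nonzero vectors that generates is a basis. Finally, `affSum χ Z` is an integer multiple of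
a root of unity and the summands of the recursion formulas have disjoint supports, so that
coefficients of this form are never added (`isIntMulRoot_comb`, `isIntMulRoot_affSum`).
-/

namespace SubspaceLattice

noncomputable section

open scoped Classical

/-! ### Coordinates of vectors and operators -/

section Operators

variable {P Q : Type*} [Fintype P] [Fintype Q]

lemma basisVec_apply (x y : P) : basisVec x y = if y = x then (1 : ℂ) else 0 := by
  simp [basisVec, EuclideanSpace.basisFun_apply, PiLp.single_apply]

lemma sum_basisVec_apply (s : Finset P) (y : P) :
    (∑ x ∈ s, (basisVec x : V P)) y = if y ∈ s then 1 else 0 := by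
  simp [Finset.sum_apply, basisVec_apply]

lemma linExt_eq_sum {W : Type*} [AddCommGroup W] [Module ℂ W] (f : P → W) (v : V P) :
    linExt f v = ∑ x, v x • f x := by
  simp [linExt, Module.Basis.constr_apply_fintype]

lemma linExt_basisVec {W : Type*} [AddCommGroup W] [Module ℂ W] (f : P → W) (x : P) :
    linExt f (basisVec x) = f x := by
  simp [linExt_eq_sum, basisVec_apply]

lemma linExt_apply (f : P → V Q) (v : V P) (y : Q) :
    linExt f v y = ∑ x, v x * f x y := by
  simp [linExt_eq_sum]

lemma span_basisVec : Submodule.span ℂ (Set.range (basisVec : P → V P)) = ⊤ := by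
  have h := (EuclideanSpace.basisFun P ℂ).toBasis.span_eq
  rw [← h]
  congr 1

lemma up_apply [PartialOrder P] (v : V P) (y : P) :
    up P v y = ∑ x with x ⋖ y, v x := by
  rw [up, linExt_apply, Finset.sum_filter]
  refine Finset.sum_congr rfl fun x _ => ?_
  simp [sum_basisVec_apply]

lemma inner_apply (v w : V P) : inner ℂ v w = ∑ x, (starRingEnd ℂ) (v x) * w x := by
  simp [PiLp.inner_apply, mul_comm]

lemma inner_eq_zero_of_homogeneous {r : P → ℕ} {i j : ℕ} (h : i ≠ j) {v w : V P}
    (hv : IsHomogeneous r i v) (hw : IsHomogeneous r j w) : inner ℂ v w = 0 := by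
  rw [inner_apply]
  refine Finset.sum_eq_zero fun x _ => ?_
  by_contra hne
  have h1 : v x ≠ 0 := fun h0 => hne (by simp [h0])
  have h2 : w x ≠ 0 := fun h0 => hne (by simp [h0])
  exact h ((hv x h1).symm.trans (hw x h2))

lemma IsHomogeneous.zero (r : P → ℕ) (i : ℕ) : IsHomogeneous r i (0 : V P) := by
  intro x hx; simp at hx

lemma IsHomogeneous.add {r : P → ℕ} {i : ℕ} {v w : V P} (hv : IsHomogeneous r i v)
    (hw : IsHomogeneous r i w) : IsHomogeneous r i (v + w) := by
  intro x hx
  by_cases h : v x = 0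
  · exact hw x fun h' => hx (by simp [h, h'])
  · exact hv x h

lemma IsHomogeneous.smul {r : P → ℕ} {i : ℕ} {v : V P} (a : ℂ) (hv : IsHomogeneous r i v) :
    IsHomogeneous r i (a • v) := by
  intro x hx
  exact hv x fun h' => hx (by simp [h'])

end Operators

/-! ### Subspaces of a space and of a hyperplane in it -/

section Cone

variable {F : Type*} [Field F] {n : ℕ}

/-- The vector `(a, 1)`. -/
def affPt (a : Fin n → F) : Fin (n + 1) → F := Fin.snoc (α := fun _ => F) a 1

/-- The subspace of `F ^ (n + 1)` spanned by `X ⊆ F ^ n` and `(a, 1)`. -/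
def cone (a : Fin n → F) (X : B F n) : B F (n + 1) :=
  X.map (incl F n) ⊔ Submodule.span F {affPt a}

@[simp] lemma incl_castSucc (v : Fin n → F) (i : Fin n) : incl F n v i.castSucc = v i := by
  simp [incl]

@[simp] lemma incl_last (v : Fin n → F) : incl F n v (Fin.last n) = 0 := by
  simp [incl]

@[simp] lemma affPt_castSucc (v : Fin n → F) (i : Fin n) : affPt v i.castSucc = v i := by
  simp [affPt]

@[simp] lemma affPt_last (v : Fin n → F) : affPt v (Fin.last n) = 1 := by
  simp [affPt]

lemma incl_injective : Function.Injective (incl F n) := by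
  intro v w h
  ext i
  simpa using congrFun h i.castSucc

lemma mem_range_incl {v : Fin (n + 1) → F} :
    v ∈ LinearMap.range (incl F n) ↔ v (Fin.last n) = 0 := by
  constructor
  · rintro ⟨w, rfl⟩; simp
  · intro h
    refine ⟨fun i => v i.castSucc, ?_⟩
    ext i
    refine Fin.lastCases ?_ (fun j => ?_) i <;> simp [h]

lemma mem_A_iff {Z : B F (n + 1)} : Z ∈ A F n ↔ ∃ a, affPt a ∈ Z := by
  constructor
  · intro h
    obtain ⟨v, hv, hv'⟩ := SetLike.not_le_iff_exists.1 h
    rw [mem_range_incl] at hv'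
    refine ⟨fun i => (v (Fin.last n))⁻¹ * v i.castSucc, ?_⟩
    convert Z.smul_mem (v (Fin.last n))⁻¹ hv using 1
    ext i
    refine Fin.lastCases ?_ (fun j => ?_) i <;> simp [hv']
  · rintro ⟨a, ha⟩ h
    simpa using mem_range_incl.1 (h ha)

lemma hyperInter_mono {Z Z' : B F (n + 1)} (h : Z ≤ Z') : hyperInter Z ≤ hyperInter Z' :=
  Submodule.comap_mono h

lemma map_hyperInter {Z : B F (n + 1)} (h : Z ≤ LinearMap.range (incl F n)) :
    (hyperInter Z).map (incl F n) = Z :=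
  Submodule.map_comap_eq_of_le h

lemma hyperInter_map (X : B F n) : hyperInter (X.map (incl F n)) = X :=
  Submodule.comap_map_eq_of_injective incl_injective X

lemma map_incl_le_range (X : B F n) : X.map (incl F n) ≤ LinearMap.range (incl F n) :=
  LinearMap.map_le_range

lemma affPt_mem_cone (a : Fin n → F) (X : B F n) : affPt a ∈ cone a X :=
  (le_sup_right : _ ≤ cone a X) (Submodule.mem_span_singleton_self _)

lemma cone_le_iff {a : Fin n → F} {X : B F n} {Z : B F (n + 1)} :
    cone a X ≤ Z ↔ affPt a ∈ Z ∧ X ≤ hyperInter Z := by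
  rw [cone, sup_le_iff, Submodule.span_singleton_le_iff_mem, Submodule.map_le_iff_le_comap,
    and_comm, hyperInter]

@[simp] lemma hyperInter_cone (a : Fin n → F) (X : B F n) : hyperInter (cone a X) = X := by
  refine le_antisymm (fun v hv => ?_) (cone_le_iff.1 le_rfl).2
  obtain ⟨y, ⟨x, hx, rfl⟩, z, hz, h⟩ := Submodule.mem_sup.1 (show incl F n v ∈ cone a X from hv)
  obtain ⟨c, rfl⟩ := Submodule.mem_span_singleton.1 hz
  have hc : c = 0 := by simpa using congrFun h (Fin.last n)
  rw [hc, zero_smul, add_zero] at h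
  rwa [← incl_injective h]

lemma cone_hyperInter {a : Fin n → F} {Z : B F (n + 1)} (ha : affPt a ∈ Z) :
    cone a (hyperInter Z) = Z := by
  refine le_antisymm (cone_le_iff.2 ⟨ha, le_rfl⟩) fun v hv => ?_
  have h : v - v (Fin.last n) • affPt a ∈ (hyperInter Z).map (incl F n) := by
    have h1 : v - v (Fin.last n) • affPt a ∈ LinearMap.range (incl F n) := by
      rw [mem_range_incl]; simp
    obtain ⟨w, hw⟩ := h1
    refine ⟨w, ?_, hw⟩
    change incl F n w ∈ Z
    rw [hw]
    exact Z.sub_mem hv (Z.smul_mem _ ha)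
  refine Submodule.mem_sup.2 ⟨_, h, v (Fin.last n) • affPt a,
    Submodule.smul_mem _ _ (Submodule.mem_span_singleton_self _), ?_⟩
  simp

lemma cone_eq_iff {a : Fin n → F} {X : B F n} {Z : B F (n + 1)} :
    cone a X = Z ↔ affPt a ∈ Z ∧ hyperInter Z = X := by
  constructor
  · rintro rfl
    exact ⟨affPt_mem_cone a X, hyperInter_cone a X⟩
  · rintro ⟨ha, rfl⟩
    exact cone_hyperInter ha

lemma affPt_mem_cone_iff {a b : Fin n → F} {X : B F n} : affPt b ∈ cone a X ↔ b - a ∈ X := by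
  have h : affPt b = incl F n (b - a) + affPt a := by
    ext i
    refine Fin.lastCases ?_ (fun j => ?_) i <;> simp
  rw [h, Submodule.add_mem_iff_left _ (affPt_mem_cone a X)]
  change b - a ∈ hyperInter (cone a X) ↔ _
  rw [hyperInter_cone]

lemma map_shear_hat (a : Fin n → F) (X : B F n) : (hat X).map (shear a) = cone a X := by
  rw [hat, Submodule.map_sup, cone, ← Submodule.map_comp, Submodule.map_span, Set.image_singleton]
  congr 3
  · ext v i
    simp [shear]
  · ext i
    refine Fin.lastCases ?_ (fun j => ?_) i <;> simp [shear]

lemma hat_eq_cone (X : B F n) : hat X = cone 0 X := by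
  rw [hat, cone]
  congr 3
  ext i
  refine Fin.lastCases ?_ (fun j => ?_) i <;> simp

/-- Taking the span with `(a, 1)` identifies the subspaces of `F ^ n` with those subspaces of
`F ^ (n + 1)` that contain `(a, 1)`. -/
def coneEmb (a : Fin n → F) : B F n ↪o B F (n + 1) :=
  OrderEmbedding.ofMapLEIff (cone a) fun X Y => by
    simp [cone_le_iff, affPt_mem_cone]

lemma cone_covBy_iff {a : Fin n → F} {X : B F n} {Z : B F (n + 1)} :
    cone a X ⋖ Z ↔ affPt a ∈ Z ∧ X ⋖ hyperInter Z := by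
  have key : ∀ Y, cone a X ⋖ cone a Y ↔ X ⋖ Y := fun Y => by
    refine Set.OrdConnected.apply_covBy_apply_iff (coneEmb a) (Set.ordConnected_def.2 ?_)
    rintro _ ⟨X, rfl⟩ _ - Z hZ
    exact ⟨hyperInter Z, cone_hyperInter (hZ.1 (affPt_mem_cone a X))⟩
  constructor
  · intro h
    have ha : affPt a ∈ Z := h.le (affPt_mem_cone a X)
    rw [← cone_hyperInter ha, key] at h
    exact ⟨ha, h⟩
  · rintro ⟨ha, h⟩
    rw [← cone_hyperInter ha, key]
    exact h

/-- An injective linear map induces an embedding of subspace lattices onto a lower set. -/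
lemma map_covBy_map_iff {m : ℕ} {f : (Fin m → F) →ₗ[F] (Fin n → F)} (hf : Function.Injective f)
    {X Y : B F m} : X.map f ⋖ Y.map f ↔ X ⋖ Y := by
  refine Set.OrdConnected.apply_covBy_apply_iff (OrderEmbedding.ofMapLEIff
    (Submodule.map f) fun _ _ => Submodule.map_le_map_iff_of_injective hf _ _)
    (Set.ordConnected_def.2 ?_)
  rintro _ - _ ⟨Y, rfl⟩ Z hZ
  exact ⟨Z.comap f, Submodule.map_comap_eq_of_le (hZ.2.trans LinearMap.map_le_range)⟩

lemma dim_map {m : ℕ} {f : (Fin m → F) →ₗ[F] (Fin n → F)} (hf : Function.Injective f)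
    (X : B F m) : dim (X.map f) = dim X :=
  (Submodule.equivMapOfInjective f hf X).finrank_eq.symm

lemma dim_of_covBy {X Y : B F n} (h : X ⋖ Y) : dim Y = dim X + 1 := by
  obtain ⟨v, hv, hv'⟩ := SetLike.exists_of_lt h.lt
  have h1 : X ⊔ Submodule.span F {v} = Y := by
    refine (h.eq_or_eq le_sup_left (sup_le h.le ?_)).resolve_left fun h2 => hv' ?_
    · rwa [Submodule.span_singleton_le_iff_mem]
    · rw [← h2]
      exact (le_sup_right : _ ≤ X ⊔ Submodule.span F {v}) (Submodule.mem_span_singleton_self v)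
  rw [← h1]
  exact Submodule.finrank_sup_span_singleton hv'

lemma hyperInter_covBy {Z : B F (n + 1)} (h : Z ∈ A F n) :
    (hyperInter Z).map (incl F n) ⋖ Z := by
  obtain ⟨a, ha⟩ := mem_A_iff.1 h
  conv_rhs => rw [← cone_hyperInter ha, cone, sup_comm]
  refine Submodule.covBy_span_singleton_sup fun h' => ?_
  simpa using mem_range_incl.1 (map_incl_le_range _ h')

lemma dim_of_mem_A {Z : B F (n + 1)} (h : Z ∈ A F n) : dim Z = dim (hyperInter Z) + 1 := by
  rw [dim_of_covBy (hyperInter_covBy h), dim_map incl_injective]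

lemma dim_of_notMem_A {Z : B F (n + 1)} (h : Z ∉ A F n) : dim Z = dim (hyperInter Z) := by
  conv_lhs => rw [← map_hyperInter (not_not.1 h), dim_map incl_injective]

lemma eq_bot_or_eq_top (X : B F 1) : X = ⊥ ∨ X = ⊤ := by
  have h : Module.finrank F X ≤ 1 := by simpa using Submodule.finrank_le X
  rcases Nat.le_one_iff_eq_zero_or_eq_one.1 h with h | h
  · exact Or.inl (Submodule.finrank_eq_zero.1 h)
  · exact Or.inr (Submodule.eq_top_of_finrank_eq (by simpa using h))

end Cone

/-! ### The isotypical components -/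

section Spread

variable {F : Type*} [Field F] [Fintype F] {n : ℕ}

/-- The sum of the conjugate character values over the points of the affine space that `Z` cuts
out of the hyperplane of vectors with last component `1`. -/
def affSum (χ : AddChar (Fin n → F) ℂ) (Z : B F (n + 1)) : ℂ :=
  ∑ a with affPt a ∈ Z, (starRingEnd ℂ) (χ a)

/-- The sum of the conjugate character values over `X`. -/
def subSum (χ : AddChar (Fin n → F) ℂ) (X : B F n) : ℂ :=
  ∑ a with a ∈ X, (starRingEnd ℂ) (χ a)

/-- The function `w` on the subspaces of `F ^ n`, pulled back along `hyperInter` and twisted by `χ`.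
It vanishes on the subspaces contained in `F ^ n`, for which `affSum χ` is an empty sum. All of
`theta`, `gamma χ` and `charSum χ` (at vectors `hat X`) have values of this form. -/
def spread (χ : AddChar (Fin n → F) ℂ) (w : B F n → ℂ) : V (B F (n + 1)) :=
  WithLp.toLp 2 fun Z => affSum χ Z * w (hyperInter Z)

lemma spread_apply (χ : AddChar (Fin n → F) ℂ) (w : B F n → ℂ) (Z : B F (n + 1)) :
    spread χ w Z = affSum χ Z * w (hyperInter Z) := rfl

lemma card_subspace (X : B F n) : (Fintype.card X : ℂ) = (Fintype.card F : ℂ) ^ dim X := by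
  rw [dim, Module.card_eq_pow_finrank (K := F)]
  push_cast; rfl

lemma card_ne_zero : (Fintype.card F : ℂ) ≠ 0 := Nat.cast_ne_zero.2 Fintype.card_ne_zero

lemma subSum_eq (χ : AddChar (Fin n → F) ℂ) (X : B F n) :
    subSum χ X = if ∀ x ∈ X, χ x = 1 then (Fintype.card F : ℂ) ^ dim X else 0 := by
  have h : subSum χ X =
      (starRingEnd ℂ) (∑ a : X, χ.compAddMonoidHom X.subtype.toAddMonoidHom a) := by
    rw [subSum, map_sum]
    exact Finset.sum_subtype _ (by simp) fun a => (starRingEnd ℂ) (χ a)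
  rw [h, AddChar.sum_eq_ite]
  have h' : χ.compAddMonoidHom X.subtype.toAddMonoidHom = 0 ↔ ∀ x ∈ X, χ x = 1 := by
    rw [AddChar.eq_zero_iff]
    simp
  by_cases hx : ∀ x ∈ X, χ x = 1
  · rw [if_pos hx, if_pos (h'.2 hx), card_subspace]; simp
  · rw [if_neg hx, if_neg (mt h'.1 hx)]; simp

lemma affSum_cone (χ : AddChar (Fin n → F) ℂ) (a : Fin n → F) (X : B F n) :
    affSum χ (cone a X) = (starRingEnd ℂ) (χ a) * subSum χ X := by
  rw [affSum, subSum, Finset.mul_sum, Finset.sum_filter, Finset.sum_filter]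
  refine Fintype.sum_equiv (Equiv.subRight a) _ _ fun b => ?_
  simp only [affPt_mem_cone_iff, Equiv.subRight_apply]
  split_ifs
  · rw [← map_mul, ← AddChar.map_add_eq_mul, add_sub_cancel]
  · rfl

lemma affSum_eq_zero (χ : AddChar (Fin n → F) ℂ) {Z : B F (n + 1)} (h : Z ∉ A F n) :
    affSum χ Z = 0 := by
  rw [affSum, Finset.sum_filter]
  refine Finset.sum_eq_zero fun a _ => if_neg fun ha => h (mem_A_iff.2 ⟨a, ha⟩)

lemma affSum_one {Z : B F (n + 1)} (h : Z ∈ A F n) :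
    affSum 1 Z = (Fintype.card F : ℂ) ^ dim (hyperInter Z) := by
  obtain ⟨a, ha⟩ := mem_A_iff.1 h
  conv_lhs => rw [← cone_hyperInter ha, affSum_cone, subSum_eq]
  simp

/-- The subspaces through a point `(a, 1)` are parametrized by the subspaces of `F ^ n`. -/
lemma sum_filter_affPt_mem (a : Fin n → F) (f : B F (n + 1) → ℂ) :
    ∑ Z with affPt a ∈ Z, f Z = ∑ X, f (cone a X) := by
  refine (Finset.sum_bij' (fun X _ => cone a X) (fun Z _ => hyperInter Z) ?_ ?_ ?_ ?_ ?_).symm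
  · intro X _; simp [affPt_mem_cone]
  · simp
  · simp
  · intro Z hZ
    exact cone_hyperInter (by simpa using hZ)
  · simp

/-- Summation over pairs `(a, 1) ∈ Z`, in either order. -/
lemma sum_affSum_mul (χ : AddChar (Fin n → F) ℂ) (f : B F (n + 1) → ℂ) :
    ∑ Z, affSum χ Z * f Z = ∑ a, (starRingEnd ℂ) (χ a) * ∑ X, f (cone a X) := by
  simp_rw [← sum_filter_affPt_mem, affSum, Finset.sum_mul, Finset.mul_sum, Finset.sum_filter]
  exact Finset.sum_comm

lemma sum_mul_conj (χ χ' : AddChar (Fin n → F) ℂ) :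
    ∑ a, χ a * (starRingEnd ℂ) (χ' a) = if χ = χ' then (Fintype.card F : ℂ) ^ n else 0 := by
  have h : ∀ a, χ a * (starRingEnd ℂ) (χ' a) = (χ - χ') a := fun a => by
    rw [AddChar.sub_apply, AddChar.map_neg_eq_conj]
  simp_rw [h, AddChar.sum_eq_ite, sub_eq_zero]
  simp

/-- The components of different characters are orthogonal. Inside one component, the inner product
is a weighted inner product of the functions `w` and `w'`; the weight `subSum χ X` is `q ^ dim X` or
`0`, according as `χ` is trivial on `X` or not. -/
lemma inner_spread (χ χ' : AddChar (Fin n → F) ℂ) (w w' : B F n → ℂ) :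
    inner ℂ (spread χ w) (spread χ' w') =
      if χ = χ' then (Fintype.card F : ℂ) ^ n *
        ∑ X, subSum χ X * ((starRingEnd ℂ) (w X) * w' X) else 0 := by
  have h : ∀ Z, (starRingEnd ℂ) (spread χ w Z) * spread χ' w' Z = affSum χ' Z *
      ((starRingEnd ℂ) (affSum χ Z) * ((starRingEnd ℂ) (w (hyperInter Z)) * w' (hyperInter Z))) :=
    fun Z => by simp only [spread_apply, map_mul]; ring
  have hreal : ∀ X, (starRingEnd ℂ) (subSum χ X) = subSum χ X := fun X => by
    rw [subSum_eq]; split_ifs <;> simp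
  rw [inner_apply, Finset.sum_congr rfl fun Z _ => h Z, sum_affSum_mul]
  simp only [affSum_cone, hyperInter_cone, map_mul, RingHomCompTriple.comp_apply, RingHom.id_apply,
    hreal, mul_assoc, ← Finset.mul_sum]
  simp only [← mul_assoc, ← Finset.sum_mul]
  simp_rw [mul_comm _ (χ _), sum_mul_conj]
  split_ifs
  · simp [mul_assoc]
  · simp

/-- For `(a, 1) ∈ Z`, the subspaces covered by `Z` that contain `(a, 1)` correspond to those covered
by `hyperInter Z`. -/
lemma up_spread (χ : AddChar (Fin n → F) ℂ) (w : B F n → ℂ) :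
    up _ (spread χ w) = spread χ fun X => ∑ X' with X' ⋖ X, w X' := by
  ext Z
  rw [up_apply, Finset.sum_filter]
  have h : ∀ Z', (if Z' ⋖ Z then spread χ w Z' else 0) =
      affSum χ Z' * if Z' ⋖ Z then w (hyperInter Z') else 0 := fun Z' => by
    rw [spread_apply, mul_ite, mul_zero]
  simp_rw [h, sum_affSum_mul, hyperInter_cone, cone_covBy_iff]
  rw [spread_apply, affSum, Finset.sum_mul, Finset.sum_filter]
  refine Finset.sum_congr rfl fun a _ => ?_
  by_cases ha : affPt a ∈ Z
  · simp [ha, Finset.sum_filter]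
  · simp [ha]

lemma smul_spread (c : ℂ) (χ : AddChar (Fin n → F) ℂ) (w : B F n → ℂ) :
    c • spread χ w = spread χ fun X => c * w X := by
  ext Z
  simp only [PiLp.smul_apply, spread_apply, smul_eq_mul]
  ring

lemma charSum_hat (χ : AddChar (Fin n → F) ℂ) (X : B F n) :
    charSum χ (basisVec (hat X)) = spread χ fun Y => if Y = X then 1 else 0 := by
  ext Z
  simp only [charSum, LinearMap.sum_apply, LinearMap.smul_apply, linExt_basisVec, map_shear_hat,
    spread_apply, affSum]
  simp only [WithLp.ofLp_sum, Finset.sum_apply, PiLp.smul_apply, basisVec_apply,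
    eq_comm (a := Z), cone_eq_iff, Finset.sum_filter, Finset.sum_mul, smul_eq_mul]
  refine Finset.sum_congr rfl fun a _ => ?_
  by_cases h : affPt a ∈ Z <;> simp [h]

lemma charSum_hat_ne_zero_iff (χ : AddChar (Fin n → F) ℂ) (X : B F n) :
    charSum χ (basisVec (hat X)) ≠ 0 ↔ ∀ x ∈ X, χ x = 1 := by
  rw [charSum_hat, ← inner_self_ne_zero (𝕜 := ℂ), inner_spread, if_pos rfl]
  simp [subSum_eq]

/-- Fourier inversion on the group `F ^ n`. -/
lemma basisVec_cone (a : Fin n → F) (X : B F n) :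
    (basisVec (cone a X) : V (B F (n + 1))) = ((Fintype.card F : ℂ) ^ n)⁻¹ •
      ∑ χ : AddChar (Fin n → F) ℂ, χ a • charSum χ (basisVec (hat X)) := by
  rw [eq_inv_smul_iff₀ (pow_ne_zero _ card_ne_zero)]
  simp only [charSum, LinearMap.sum_apply, LinearMap.smul_apply, linExt_basisVec, map_shear_hat,
    Finset.smul_sum, smul_smul]
  rw [Finset.sum_comm]
  simp_rw [← Finset.sum_smul, ← AddChar.map_neg_eq_conj, ← AddChar.map_add_eq_mul,
    AddChar.sum_apply_eq_ite, ← sub_eq_add_neg, sub_eq_zero]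
  rw [Finset.sum_eq_single a]
  · simp
  · intro b _ hb; simp [hb.symm]
  · simp

end Spread

/-! ### The maps `inclV` and `theta` -/

section Theta

variable {F : Type*} [Field F] [Fintype F] {n : ℕ}

lemma theta_apply (x : V (B F n)) (Z : B F (n + 1)) :
    theta F n x Z = if Z ∈ A F n then x (hyperInter Z) else 0 := by
  rw [theta, linExt_apply]
  have h : ∀ X : B F n,
      (∑ Y with Y ∈ A F n ∧ hyperInter Y = hyperInter (hat X), (basisVec Y : V (B F (n + 1)))) Z =
        if Z ∈ A F n ∧ hyperInter Z = X then 1 else 0 := fun X => by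
    simp [sum_basisVec_apply, hat_eq_cone]
  simp_rw [h]
  by_cases hZ : Z ∈ A F n <;> simp [hZ]

/-- The values of `theta` lie in the component of the trivial character, since
`affSum 1 Z = q ^ dim (hyperInter Z)` for `Z` not contained in `F ^ n`. -/
lemma theta_eq_spread (x : V (B F n)) :
    theta F n x = spread 1 fun X => x X / (Fintype.card F : ℂ) ^ dim X := by
  ext Z
  rw [theta_apply, spread_apply]
  split_ifs with h
  · rw [affSum_one h, mul_div_cancel₀ _ (pow_ne_zero _ card_ne_zero)]
  · rw [affSum_eq_zero _ h, zero_mul]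

lemma inclV_apply (x : V (B F n)) (Z : B F (n + 1)) :
    inclV F n x Z = if Z ∈ A F n then 0 else x (hyperInter Z) := by
  rw [inclV, linExt_apply]
  have h : ∀ X : B F n, Z = X.map (incl F n) ↔ Z ∉ A F n ∧ hyperInter Z = X := fun X => by
    constructor
    · rintro rfl
      exact ⟨fun h => h (map_incl_le_range X), hyperInter_map X⟩
    · rintro ⟨h, rfl⟩
      exact (map_hyperInter (not_not.1 h)).symm
  simp only [basisVec_apply, h]
  by_cases h : Z ∈ A F n <;> simp [h]

/-- Of the subspaces of `F ^ (n + 1)` that cover `X ⊆ F ^ n`, those in `F ^ n` contribute to the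
first and the others to the second summand. -/
lemma up_inclV (x : V (B F n)) : up _ (inclV F n x) = inclV F n (up _ x) + theta F n x := by
  ext Z
  rw [PiLp.add_apply, inclV_apply, theta_apply, up_apply, up_apply]
  by_cases h : Z ∈ A F n
  · rw [if_pos h, if_pos h, zero_add, Finset.sum_eq_single ((hyperInter Z).map (incl F n))]
    · rw [inclV_apply, if_neg (fun h => h (map_incl_le_range _)), hyperInter_map]
    · intro Z' hZ' hne
      rw [inclV_apply]
      split_ifs with h'
      · rfl
      · refine absurd ?_ hne
        have hc : Z' ⋖ Z := by simpa using hZ'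
        have hle : Z' ≤ (hyperInter Z).map (incl F n) := by
          rw [← map_hyperInter (not_not.1 h')]
          exact Submodule.map_mono (hyperInter_mono hc.le)
        exact ((hc.eq_or_eq hle (hyperInter_covBy h).le).resolve_right
          (hyperInter_covBy h).lt.ne).symm
    · intro h'
      exact absurd (by simpa using hyperInter_covBy h) h'
  · rw [if_neg h, if_neg h, add_zero]
    have h0 := map_hyperInter (not_not.1 h)
    refine (Finset.sum_bij' (fun X _ => X.map (incl F n)) (fun Z _ => hyperInter Z)
      ?_ ?_ ?_ ?_ ?_).symm
    · intro X hX
      rw [Finset.mem_filter] at hX ⊢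
      rw [← h0, map_covBy_map_iff incl_injective]
      exact ⟨Finset.mem_univ _, hX.2⟩
    · intro Z' hZ'
      rw [Finset.mem_filter] at hZ' ⊢
      rw [← map_covBy_map_iff incl_injective, h0, map_hyperInter (hZ'.2.le.trans (not_not.1 h))]
      exact ⟨Finset.mem_univ _, hZ'.2⟩
    · intro X _; exact hyperInter_map X
    · intro Z' hZ'
      rw [Finset.mem_filter] at hZ'
      exact map_hyperInter (hZ'.2.le.trans (not_not.1 h))
    · intro X _
      rw [inclV_apply, if_neg (fun h => h (map_incl_le_range _)), hyperInter_map]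

lemma up_theta (x : V (B F n)) :
    up _ (theta F n x) = (Fintype.card F : ℂ) • theta F n (up _ x) := by
  rw [theta_eq_spread, theta_eq_spread, up_spread, smul_spread]
  congr 1
  ext X
  rw [up_apply, Finset.sum_div, Finset.mul_sum]
  refine Finset.sum_congr rfl fun X' hX' => ?_
  rw [dim_of_covBy (Finset.mem_filter.1 hX').2, pow_succ]
  have := card_ne_zero (F := F)
  field_simp

lemma inner_inclV_inclV (x y : V (B F n)) : inner ℂ (inclV F n x) (inclV F n y) = inner ℂ x y := by
  rw [inner_apply, inner_apply]
  symm
  rw [← Finset.sum_filter_of_ne (p := fun Z => Z ∉ A F n)]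
  · refine Finset.sum_bij' (fun X _ => X.map (incl F n)) (fun Z _ => hyperInter Z)
      ?_ ?_ ?_ ?_ ?_
    · intro X hX
      simpa [A] using map_incl_le_range X
    · simp
    · intro X _; exact hyperInter_map X
    · intro Z' hZ'
      rw [Finset.mem_filter] at hZ'
      exact map_hyperInter (not_not.1 hZ'.2)
    · intro X _
      rw [inclV_apply, inclV_apply, if_neg (fun h => h (map_incl_le_range _)), hyperInter_map,
        if_neg (fun h => h (map_incl_le_range _))]
  · intro Z _ h h'
    exact h (by simp [inclV_apply, h'])

lemma inner_inclV_spread (x : V (B F n)) (χ : AddChar (Fin n → F) ℂ) (w : B F n → ℂ) :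
    inner ℂ (inclV F n x) (spread χ w) = 0 := by
  rw [inner_apply]
  refine Finset.sum_eq_zero fun Z _ => ?_
  rw [inclV_apply, spread_apply]
  split_ifs with h
  · simp
  · simp [affSum_eq_zero _ h]

/-- For each `u`-dimensional `X` there are `q ^ (n - u)` subspaces `Z` not contained in `F ^ n` with
`hyperInter Z = X`. The homogeneity of one of the two vectors is enough. -/
lemma inner_theta_theta {x : V (B F n)} {u : ℕ} (hx : IsHomogeneous dim u x) (y : V (B F n)) :
    inner ℂ (theta F n x) (theta F n y) =
      (Fintype.card F : ℂ) ^ n / (Fintype.card F : ℂ) ^ u * inner ℂ x y := by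
  rw [theta_eq_spread, theta_eq_spread, inner_spread, if_pos rfl, inner_apply, div_mul_eq_mul_div,
    mul_div_assoc, Finset.sum_div]
  congr 1
  refine Finset.sum_congr rfl fun X _ => ?_
  by_cases h : x X = 0
  · simp [h]
  · rw [subSum_eq, if_pos (by simp), hx X h]
    have := card_ne_zero (F := F)
    simp only [map_div₀, map_pow, Complex.conj_natCast]
    by_cases h2 : y X = 0
    · simp [h2]
    · field_simp

end Theta

/-! ### The hyperplane of a nontrivial character and the map `gamma` -/

section Gamma

variable {F : Type*} [Field F] {m : ℕ}

lemma IsSchubertNormalForm.mulVecLin_injective {n k : ℕ} {M : Matrix (Fin n) (Fin k) F}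
    (hM : IsSchubertNormalForm M) : Function.Injective M.mulVecLin := by
  obtain ⟨r, -, -, h⟩ := hM
  intro y z hyz
  ext j
  simpa [Matrix.mulVec, dotProduct, h] using congrFun hyz (r j)

/-- Hyperplanes have a matrix in Schubert normal form: its columns are `e_i - (a_i / a_p) e_p` for
`i ≠ p`, where `p` is the last index with `a_p ≠ 0`. -/
lemma exists_schubertNormalForm_hyperplane {a : Fin (m + 1) → F} (ha : a ≠ 0) :
    ∃ M : Matrix (Fin (m + 1)) (Fin m) F, IsSchubertNormalForm M ∧
      ∀ x, x ∈ LinearMap.range M.mulVecLin ↔ ∑ i, a i * x i = 0 := by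
  obtain ⟨p, hp, hmax⟩ : ∃ p, a p ≠ 0 ∧ ∀ i, p < i → a i = 0 := by
    obtain ⟨i, hi⟩ := Function.ne_iff.1 ha
    obtain ⟨p, hp, hmax⟩ := (Finset.univ.filter fun i => a i ≠ 0).exists_max_image id
      ⟨i, by simpa using hi⟩
    refine ⟨p, by simpa using hp, fun i hi => ?_⟩
    by_contra h
    exact absurd (hmax i (by simpa using h)) (not_le.2 hi)
  let M : Matrix (Fin (m + 1)) (Fin m) F := fun i j =>
    if i = p then -(a (p.succAbove j)) / a p else if i = p.succAbove j then 1 else 0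
  have hMp : ∀ y, (M.mulVec y) p = ∑ j, -(a (p.succAbove j)) / a p * y j := fun y => by
    simp [Matrix.mulVec, dotProduct, M]
  have hMs : ∀ y j, (M.mulVec y) (p.succAbove j) = y j := fun y j => by
    simp [Matrix.mulVec, dotProduct, M, Fin.succAbove_ne]
  refine ⟨M, ⟨p.succAbove, Fin.strictMono_succAbove p, fun j i hi => ?_, fun j j' => ?_⟩,
    fun x => ?_⟩
  · by_cases h : i = p
    · simp [M, h, hmax _ (h ▸ hi)]
    · simp [M, h, hi.ne]
  · simp [M, Fin.succAbove_ne]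
  · rw [Fin.sum_univ_succAbove _ p]
    constructor
    · rintro ⟨y, rfl⟩
      simp only [Matrix.mulVecLin_apply, hMp, hMs, Finset.mul_sum, ← Finset.sum_add_distrib]
      refine Finset.sum_eq_zero fun j _ => ?_
      field_simp
      ring
    · intro h
      refine ⟨fun j => x (p.succAbove j), ?_⟩
      ext i
      rcases Fin.eq_self_or_eq_succAbove p i with rfl | ⟨j, rfl⟩
      · rw [Matrix.mulVecLin_apply, hMp, eq_comm, ← mul_right_inj' hp, eq_neg_of_add_eq_zero_left h,
          Finset.mul_sum, ← Finset.sum_neg_distrib]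
        refine Finset.sum_congr rfl fun j _ => ?_
        field_simp
      · rw [Matrix.mulVecLin_apply, hMs]

variable [Fintype F]

lemma addChar_sum {ι A : Type*} [AddCommMonoid A] (ψ : AddChar A ℂ) (s : Finset ι) (f : ι → A) :
    ψ (∑ i ∈ s, f i) = ∏ i ∈ s, ψ (f i) := by
  induction s using Finset.cons_induction with
  | empty => simp
  | cons i s hi ih => rw [Finset.sum_cons, Finset.prod_cons, AddChar.map_add_eq_mul, ih]

/-- Every character of `F ^ n` has the form `x ↦ ψ (∑ i, a i * x i)` for a nontrivial character `ψ`
of `F`, so it is trivial on a linear subspace `X` if and only if the form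
`∑ i, a i * x i` vanishes on `X`. -/
lemma exists_forall_eq_one_iff {n : ℕ} {χ : AddChar (Fin n → F) ℂ} (hχ : χ ≠ 1) :
    ∃ a : Fin n → F, a ≠ 0 ∧
      ∀ X : B F n, (∀ x ∈ X, χ x = 1) ↔ ∀ x ∈ X, ∑ i, a i * x i = 0 := by
  let coord : Fin n → AddChar F ℂ := fun i =>
    χ.compAddMonoidHom (LinearMap.single F (fun _ => F) i).toAddMonoidHom
  have hprod : ∀ x, χ x = ∏ i, coord i (x i) := fun x => by
    have h : x = ∑ i, Pi.single i (x i) := (Finset.univ_sum_single x).symm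
    conv_lhs => rw [h, addChar_sum]
    rfl
  obtain ⟨i, hi⟩ : ∃ i, coord i ≠ 1 := by
    by_contra! h
    refine hχ ?_
    ext x
    rw [hprod]
    simp [h]
  have hprim := AddChar.IsPrimitive.of_ne_one hi
  have hsurj : Function.Surjective (coord i).mulShift :=
    ((Fintype.bijective_iff_injective_and_card _).2
      ⟨AddChar.to_mulShift_inj_of_isPrimitive hprim, AddChar.card_eq.symm⟩).2
  choose a ha using fun j => hsurj (coord j)
  have hval : ∀ x, χ x = coord i (∑ j, a j * x j) := fun x => by
    rw [hprod, addChar_sum]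
    refine Finset.prod_congr rfl fun j _ => ?_
    rw [← ha j, AddChar.mulShift_apply]
  refine ⟨a, ?_, fun X => ⟨fun h x hx => ?_, fun h x hx => ?_⟩⟩
  · rintro rfl
    refine hχ ?_
    ext x
    simp [hval]
  · by_contra hne
    refine hprim hne ?_
    ext c
    have := h _ (X.smul_mem c hx)
    rw [hval] at this
    rw [AddChar.mulShift_apply, AddChar.one_apply, ← this, Finset.sum_mul]
    congr 1
    refine Finset.sum_congr rfl fun j _ => ?_
    simp only [Pi.smul_apply, smul_eq_mul]
    ring
  · rw [hval, h x hx, AddChar.map_zero_eq_one]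

/-- The linear map by which `gamma χ` identifies `F ^ m` with the hyperplane of `χ`. -/
def tau (χ : AddChar (Fin (m + 1) → F) ℂ) : (Fin m → F) →ₗ[F] (Fin (m + 1) → F) :=
  (schubertMatrix m (charHyperplane χ)).mulVecLin

/-- `tau χ` is an isomorphism onto the hyperplane of `χ`, which is the largest linear subspace
of the kernel of `χ`. -/
lemma tau_spec {χ : AddChar (Fin (m + 1) → F) ℂ} (hχ : χ ≠ 1) :
    Function.Injective (tau χ) ∧
      ∀ X : B F (m + 1), (∀ x ∈ X, χ x = 1) ↔ X ≤ LinearMap.range (tau χ) := by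
  obtain ⟨a, ha, hiff⟩ := exists_forall_eq_one_iff hχ
  obtain ⟨M, hM, hrange⟩ := exists_schubertNormalForm_hyperplane ha
  have hiff' : ∀ X : B F (m + 1), (∀ x ∈ X, χ x = 1) ↔ X ≤ LinearMap.range M.mulVecLin :=
    fun X => by
      rw [hiff]
      exact forall₂_congr fun x _ => (hrange x).symm
  have hdim : dim (LinearMap.range M.mulVecLin) = m := by
    rw [dim, LinearMap.finrank_range_of_inj hM.mulVecLin_injective, Module.finrank_fin_fun]
  have hK : charHyperplane χ = LinearMap.range M.mulVecLin := by
    have : {X | dim X = m ∧ charSum χ (basisVec (hat X)) ≠ 0} = {LinearMap.range M.mulVecLin} := by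
      ext X
      simp only [Set.mem_ofPred_eq, charSum_hat_ne_zero_iff, hiff', Set.mem_singleton_iff]
      constructor
      · rintro ⟨h1, h2⟩
        exact Submodule.eq_of_le_of_finrank_eq h2 (h1.trans hdim.symm)
      · rintro rfl
        exact ⟨hdim, le_rfl⟩
    rw [charHyperplane, this, sSup_singleton]
  have hex : ∃ M : Matrix (Fin (m + 1)) (Fin m) F,
      IsSchubertNormalForm M ∧ LinearMap.range M.mulVecLin = charHyperplane χ := ⟨M, hM, hK.symm⟩
  obtain ⟨hM', hrange'⟩ : IsSchubertNormalForm (schubertMatrix m (charHyperplane χ)) ∧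
      LinearMap.range (tau χ) = charHyperplane χ := by
    rw [tau, schubertMatrix, dif_pos hex]
    exact hex.choose_spec
  rw [hrange', hK]
  exact ⟨hM'.mulVecLin_injective, hiff'⟩

lemma forall_mem_hyperInter_of_affSum_ne_zero {n : ℕ} {χ : AddChar (Fin n → F) ℂ}
    {Z : B F (n + 1)} (h : affSum χ Z ≠ 0) : ∀ x ∈ hyperInter Z, χ x = 1 := by
  have hA : Z ∈ A F n := by
    by_contra hA
    exact h (affSum_eq_zero χ hA)
  obtain ⟨a, ha⟩ := mem_A_iff.1 hA
  rw [← cone_hyperInter ha, affSum_cone, subSum_eq] at h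
  by_contra hne
  simp [hne] at h

lemma spread_congr {n : ℕ} {χ : AddChar (Fin n → F) ℂ} {w w' : B F n → ℂ}
    (h : ∀ X : B F n, (∀ x ∈ X, χ x = 1) → w X = w' X) : spread χ w = spread χ w' := by
  ext Z
  rw [spread_apply, spread_apply]
  by_cases h0 : affSum χ Z = 0
  · simp [h0]
  · rw [h _ (forall_mem_hyperInter_of_affSum_ne_zero h0)]

lemma gamma_eq_spread {χ : AddChar (Fin (m + 1) → F) ℂ} (hχ : χ ≠ 1) (x : V (B F m)) :
    gamma χ x = spread χ fun X => x (X.comap (tau χ)) := by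
  obtain ⟨hinj, hiff⟩ := tau_spec hχ
  have h : gamma χ x = spread χ fun X => ∑ Y, x Y * if X = Y.map (tau χ) then 1 else 0 := by
    rw [gamma, linExt_eq_sum]
    simp only [charSum_hat, smul_spread]
    ext Z
    simp only [WithLp.ofLp_sum, Finset.sum_apply, spread_apply, Finset.mul_sum]
    rfl
  rw [h]
  refine spread_congr fun X hX => ?_
  rw [Finset.sum_eq_single (X.comap (tau χ))]
  · rw [if_pos (Submodule.map_comap_eq_of_le ((hiff X).1 hX)).symm, mul_one]
  · intro Y _ hY
    rw [if_neg, mul_zero]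
    rintro rfl
    exact hY (Submodule.comap_map_eq_of_injective hinj Y).symm
  · simp

/-- The up operator sends `spread χ w` to the spread of the sums of `w` over covered subspaces, and
only the subspaces of the hyperplane of `χ` matter. -/
lemma up_gamma {χ : AddChar (Fin (m + 1) → F) ℂ} (hχ : χ ≠ 1) (x : V (B F m)) :
    up _ (gamma χ x) = gamma χ (up _ x) := by
  obtain ⟨hinj, hiff⟩ := tau_spec hχ
  rw [gamma_eq_spread hχ, gamma_eq_spread hχ, up_spread]
  refine spread_congr fun X hX => ?_
  have hX' : X ≤ LinearMap.range (tau χ) := (hiff X).1 hX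
  have h0 : (X.comap (tau χ)).map (tau χ) = X := Submodule.map_comap_eq_of_le hX'
  rw [up_apply]
  refine (Finset.sum_bij' (fun Y _ => Y.map (tau χ)) (fun X _ => X.comap (tau χ))
    ?_ ?_ ?_ ?_ ?_).symm
  · intro Y hY
    rw [Finset.mem_filter] at hY ⊢
    refine ⟨Finset.mem_univ _, ?_⟩
    rw [← h0]
    exact (map_covBy_map_iff hinj).2 hY.2
  · intro X' h
    rw [Finset.mem_filter] at h ⊢
    refine ⟨Finset.mem_univ _, ?_⟩
    rw [← map_covBy_map_iff hinj, h0, Submodule.map_comap_eq_of_le (h.2.le.trans hX')]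
    exact h.2
  · intro Y _
    exact Submodule.comap_map_eq_of_injective hinj Y
  · intro X' h
    rw [Finset.mem_filter] at h
    exact Submodule.map_comap_eq_of_le (h.2.le.trans hX')
  · intro Y _
    rw [Submodule.comap_map_eq_of_injective hinj Y]

lemma inner_gamma_gamma {χ : AddChar (Fin (m + 1) → F) ℂ} (hχ : χ ≠ 1) {x : V (B F m)} {u : ℕ}
    (hx : IsHomogeneous dim u x) (y : V (B F m)) :
    inner ℂ (gamma χ x) (gamma χ y) = (Fintype.card F : ℂ) ^ (m + 1 + u) * inner ℂ x y := by
  obtain ⟨hinj, hiff⟩ := tau_spec hχ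
  rw [gamma_eq_spread hχ, gamma_eq_spread hχ, inner_spread, if_pos rfl, inner_apply,
    pow_add _ (m + 1) u, mul_assoc]
  congr 1
  rw [Finset.mul_sum]
  rw [← Finset.sum_filter_of_ne (p := fun X => X ≤ LinearMap.range (tau χ))]
  · refine (Finset.sum_bij' (fun Y _ => Y.map (tau χ)) (fun X _ => X.comap (tau χ))
      ?_ ?_ ?_ ?_ ?_).symm
    · intro Y _
      simpa using LinearMap.map_le_range
    · simp
    · intro Y _
      exact Submodule.comap_map_eq_of_injective hinj Y
    · intro X h
      rw [Finset.mem_filter] at h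
      exact Submodule.map_comap_eq_of_le h.2
    · intro Y _
      rw [Submodule.comap_map_eq_of_injective hinj Y, subSum_eq,
        if_pos ((hiff _).2 LinearMap.map_le_range), dim_map hinj]
      by_cases h : x Y = 0
      · simp [h]
      · rw [hx Y h]
  · intro X _ h
    by_contra hX
    rw [← hiff] at hX
    simp [subSum_eq, hX] at h

/-! ### Homogeneity, generation and coefficients -/

lemma IsHomogeneous.inclV {n : ℕ} {x : V (B F n)} {u : ℕ} (hx : IsHomogeneous dim u x) :
    IsHomogeneous dim u (inclV F n x) := by
  intro Z hZ
  rw [inclV_apply] at hZ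
  split_ifs at hZ with h
  · exact absurd rfl hZ
  · rw [dim_of_notMem_A h, hx _ hZ]

lemma IsHomogeneous.theta {n : ℕ} {x : V (B F n)} {u : ℕ} (hx : IsHomogeneous dim u x) :
    IsHomogeneous dim (u + 1) (theta F n x) := by
  intro Z hZ
  rw [theta_apply] at hZ
  split_ifs at hZ with h
  · rw [dim_of_mem_A h, hx _ hZ]
  · exact absurd rfl hZ

lemma IsHomogeneous.gamma {χ : AddChar (Fin (m + 1) → F) ℂ} (hχ : χ ≠ 1) {x : V (B F m)} {u : ℕ}
    (hx : IsHomogeneous dim u x) : IsHomogeneous dim (u + 1) (gamma χ x) := by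
  obtain ⟨hinj, hiff⟩ := tau_spec hχ
  intro Z hZ
  rw [gamma_eq_spread hχ, spread_apply] at hZ
  have h1 := left_ne_zero_of_mul hZ
  have h2 : ((hyperInter Z).comap (tau χ)).map (tau χ) = hyperInter Z :=
    Submodule.map_comap_eq_of_le ((hiff _).1 (forall_mem_hyperInter_of_affSum_ne_zero h1))
  have hA : Z ∈ A F (m + 1) := by
    by_contra hA
    exact h1 (affSum_eq_zero χ hA)
  rw [dim_of_mem_A hA, ← h2, dim_map hinj, hx _ (right_ne_zero_of_mul hZ)]

/-- The images of the maps `inclV`, `theta` and `gamma χ` generate. A subspace contained in the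
hyperplane `F ^ n` is in the image of `inclV`; any other one is a combination of vectors
`charSum χ (hat X)` by Fourier inversion, and these are multiples of `theta X` if `χ` is trivial,
values of `gamma χ` if `χ` is trivial on `X`, and `0` otherwise. -/
lemma span_images_eq_top (S : Submodule ℂ (V (B F (m + 2))))
    (hincl : ∀ x, inclV F (m + 1) x ∈ S) (htheta : ∀ x, theta F (m + 1) x ∈ S)
    (hgamma : ∀ χ : AddChar (Fin (m + 1) → F) ℂ, χ ≠ 1 → ∀ x, gamma χ x ∈ S) : S = ⊤ := by
  rw [← top_le_iff, ← span_basisVec, Submodule.span_le]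
  rintro _ ⟨Z, rfl⟩
  by_cases hZ : Z ∈ A F (m + 1)
  · obtain ⟨a, ha⟩ := mem_A_iff.1 hZ
    rw [← cone_hyperInter ha, basisVec_cone]
    refine S.smul_mem _ (S.sum_mem fun χ _ => S.smul_mem _ ?_)
    set X := hyperInter Z
    by_cases hχ : χ = 1
    · have h : charSum χ (basisVec (hat X)) =
          (Fintype.card F : ℂ) ^ dim X • theta F (m + 1) (basisVec X) := by
        rw [charSum_hat, theta_eq_spread, smul_spread, hχ]
        congr 1
        ext Y
        rw [basisVec_apply]
        split_ifs with h
        · rw [h, mul_div_cancel₀ _ (pow_ne_zero _ card_ne_zero)]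
        · simp
      rw [h]
      exact S.smul_mem _ (htheta _)
    · obtain ⟨hinj, hiff⟩ := tau_spec hχ
      by_cases hX : ∀ x ∈ X, χ x = 1
      · have h : charSum χ (basisVec (hat X)) = gamma χ (basisVec (X.comap (tau χ))) := by
          rw [gamma, linExt_basisVec]
          change _ = charSum χ (basisVec (hat ((X.comap (tau χ)).map (tau χ))))
          rw [Submodule.map_comap_eq_of_le ((hiff X).1 hX)]
        rw [h]
        exact hgamma χ hχ _
      · rw [not_not.1 (mt (charSum_hat_ne_zero_iff χ X).1 hX)]
        exact S.zero_mem
  · have h : (basisVec Z : V (B F (m + 2))) = inclV F (m + 1) (basisVec (hyperInter Z)) := by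
      rw [inclV, linExt_basisVec, map_hyperInter (not_not.1 hZ)]
    rw [h]
    exact hincl _

/-- Integral multiples of `q`-th roots of unity. -/
def IsIntMulRoot (q : ℕ) (z : ℂ) : Prop := ∃ (m : ℤ) (ζ : ℂ), ζ ^ q = 1 ∧ z = m * ζ

lemma IsIntMulRoot.intCast_mul {q : ℕ} {z : ℂ} (m : ℤ) (hz : IsIntMulRoot q z) :
    IsIntMulRoot q (m * z) := by
  obtain ⟨m', ζ, hζ, rfl⟩ := hz
  exact ⟨m * m', ζ, hζ, by push_cast; ring⟩

lemma IsIntMulRoot.mul {q : ℕ} {z w : ℂ} (hz : IsIntMulRoot q z) (hw : IsIntMulRoot q w) :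
    IsIntMulRoot q (z * w) := by
  obtain ⟨m, ζ, hζ, rfl⟩ := hz
  obtain ⟨m', ζ', hζ', rfl⟩ := hw
  exact ⟨m * m', ζ * ζ', by rw [mul_pow, hζ, hζ', one_mul], by push_cast; ring⟩

lemma IsIntMulRoot.zero (q : ℕ) : IsIntMulRoot q 0 := ⟨0, 1, by simp, by simp⟩

lemma isIntMulRoot_affSum {n : ℕ} (χ : AddChar (Fin n → F) ℂ) (Z : B F (n + 1)) :
    IsIntMulRoot (Fintype.card F) (affSum χ Z) := by
  by_cases hA : Z ∈ A F n
  · obtain ⟨a, ha⟩ := mem_A_iff.1 hA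
    rw [← cone_hyperInter ha, affSum_cone, subSum_eq]
    split_ifs
    · refine ⟨(Fintype.card F : ℤ) ^ dim (hyperInter Z), (starRingEnd ℂ) (χ a), ?_, ?_⟩
      · rw [← map_pow, ← AddChar.map_nsmul_eq_pow]
        have : Fintype.card F • a = 0 := by
          ext i
          simp
        rw [this, AddChar.map_zero_eq_one, map_one]
      · push_cast; ring
    · rw [mul_zero]; exact .zero _
  · rw [affSum_eq_zero χ hA]; exact .zero _

end Gamma

/-! ### The q-integers -/

section QInt

lemma qInt_zero (q : ℕ) : qInt q 0 = 0 := by simp [qInt]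

lemma qInt_one (q : ℕ) : qInt q 1 = 1 := by simp [qInt]

lemma qInt_add (q a b : ℕ) : qInt q (a + b) = qInt q a + q ^ a * qInt q b := by
  simp [qInt, Finset.sum_range_add, pow_add, Finset.mul_sum]

lemma qInt_pos (q : ℕ) {m : ℕ} (hm : 0 < m) : 0 < qInt q m := by
  obtain ⟨m, rfl⟩ := Nat.exists_eq_succ_of_ne_zero hm.ne'
  rw [Nat.succ_eq_add_one, add_comm, qInt_add, qInt_one]
  omega

end QInt

/-! ### Chains and their terms -/

section Chains

variable {F : Type*} [Field F] [Fintype F] {n : ℕ}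

lemma Chain.get_of_mem {W : Type*} [Zero W] {c : Chain W} {u : ℕ} (h : c.start ≤ u)
    (h' : u ≤ c.finish) : c.get u = c.vec u := if_pos ⟨h, h'⟩

lemma Chain.get_of_lt {W : Type*} [Zero W] {c : Chain W} {u : ℕ} (h : u < c.start) :
    c.get u = 0 := if_neg fun h' => by omega

lemma Chain.get_of_gt {W : Type*} [Zero W] {c : Chain W} {u : ℕ} (h : c.finish < u) :
    c.get u = 0 := if_neg fun h' => by omega

lemma IsGradedJordanChain.homogeneous_get {P : Type*} [Fintype P] [PartialOrder P] {r : P → ℕ}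
    {c : Chain (V P)} (hc : IsGradedJordanChain r c) (u : ℕ) : IsHomogeneous r u (c.get u) := by
  rw [Chain.get]
  split_ifs with h
  · exact hc.homogeneous u h.1 h.2
  · exact .zero r u

lemma IsGradedJordanChain.up_get {P : Type*} [Fintype P] [PartialOrder P] {r : P → ℕ}
    {c : Chain (V P)} (hc : IsGradedJordanChain r c) {u : ℕ} (hu : c.start ≤ u) :
    up P (c.get u) = c.get (u + 1) := by
  rcases lt_trichotomy u c.finish with h | rfl | h
  · rw [Chain.get_of_mem hu h.le, Chain.get_of_mem (by omega) h, hc.up_vec u hu h]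
  · rw [Chain.get_of_mem hu le_rfl, Chain.get_of_gt (by omega), hc.up_finish]
  · rw [Chain.get_of_gt h, Chain.get_of_gt (by omega), map_zero]

/-- A chain may be checked through its terms `c.get u`. -/
lemma IsGradedJordanChain.of_get {P : Type*} [Fintype P] [PartialOrder P] {r : P → ℕ}
    {c : Chain (V P)} (hle : c.start ≤ c.finish) (hhom : ∀ u, IsHomogeneous r u (c.get u))
    (hne : ∀ u, c.start ≤ u → u ≤ c.finish → c.get u ≠ 0)
    (hup : ∀ u, c.start ≤ u → u ≤ c.finish → up P (c.get u) = c.get (u + 1)) :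
    IsGradedJordanChain r c where
  start_le_finish := hle
  homogeneous u h h' := by rw [← Chain.get_of_mem h h']; exact hhom u
  ne_zero u h h' := by rw [← Chain.get_of_mem h h']; exact hne u h h'
  up_vec u h h' := by
    rw [← Chain.get_of_mem h h'.le, hup u h h'.le, Chain.get_of_mem (by omega) h']
  up_finish := by
    rw [← Chain.get_of_mem hle le_rfl, hup _ hle le_rfl, Chain.get_of_gt (by omega)]

/-- The squared form of the formula for the norm ratios `‖x_{u+1}‖ / ‖x_u‖` in a chain; the factor
`[n-k-u]` appears as `[c.finish - u]`. -/
def HasNormRatios (c : Chain (V (B F n))) : Prop :=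
  ∀ u, c.start ≤ u → u < c.finish → ‖c.get (u + 1)‖ ^ 2 =
    (Fintype.card F : ℝ) ^ c.start * qInt (Fintype.card F) (u + 1 - c.start) *
      qInt (Fintype.card F) (c.finish - u) * ‖c.get u‖ ^ 2

/-- The formula also holds at the end of the chain, where both sides vanish. -/
lemma HasNormRatios.le {c : Chain (V (B F n))} (hc : HasNormRatios c) {u : ℕ}
    (h : c.start ≤ u) (h' : u ≤ c.finish) : ‖c.get (u + 1)‖ ^ 2 =
    (Fintype.card F : ℝ) ^ c.start * qInt (Fintype.card F) (u + 1 - c.start) *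
      qInt (Fintype.card F) (c.finish - u) * ‖c.get u‖ ^ 2 := by
  rcases h'.lt_or_eq with h' | rfl
  · exact hc u h h'
  · rw [Chain.get_of_gt (by omega)]
    simp [qInt_zero]

lemma inner_comb {x' : V (B F n)} {u : ℕ} (hx' : IsHomogeneous dim u x') (x y y' : V (B F n))
    (a b c d : ℂ) :
    inner ℂ (a • inclV F n x + b • theta F n x') (c • inclV F n y + d • theta F n y') =
      (starRingEnd ℂ) a * c * inner ℂ x y +
        (starRingEnd ℂ) b * d * ((Fintype.card F : ℂ) ^ n / (Fintype.card F : ℂ) ^ u) *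
          inner ℂ x' y' := by
  have h1 : inner ℂ (inclV F n x) (theta F n y') = 0 := by
    rw [theta_eq_spread, inner_inclV_spread]
  have h2 : inner ℂ (theta F n x') (inclV F n y) = 0 := by
    rw [inner_eq_zero_symm, theta_eq_spread, inner_inclV_spread]
  simp only [inner_add_left, inner_add_right, inner_smul_left, inner_smul_right, h1, h2,
    inner_inclV_inclV, inner_theta_theta hx']
  ring

lemma norm_comb {x' : V (B F n)} {u : ℕ} (hx' : IsHomogeneous dim u x') (x : V (B F n))
    (a b : ℂ) :
    ‖a • inclV F n x + b • theta F n x'‖ ^ 2 = ‖a‖ ^ 2 * ‖x‖ ^ 2 +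
      ‖b‖ ^ 2 * ((Fintype.card F : ℝ) ^ n / (Fintype.card F : ℝ) ^ u) * ‖x'‖ ^ 2 := by
  have h := inner_comb hx' x x x' a b a b
  simp only [inner_self_eq_norm_sq_to_K, ← Complex.normSq_eq_conj_mul_self,
    Complex.normSq_eq_norm_sq] at h
  apply Complex.ofReal_injective
  push_cast at h ⊢
  exact h

lemma inner_comb_gamma {m : ℕ} {χ : AddChar (Fin (m + 1) → F) ℂ} (hχ : χ ≠ 1)
    (x x' : V (B F (m + 1))) (y : V (B F m)) (a b : ℂ) :
    inner ℂ (a • inclV F (m + 1) x + b • theta F (m + 1) x') (gamma χ y) = 0 := by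
  rw [gamma_eq_spread hχ, inner_add_left, inner_smul_left, inner_smul_left, inner_inclV_spread,
    theta_eq_spread, inner_spread, if_neg (Ne.symm hχ)]
  simp

variable {c : Chain (V (B F n))}

/-- The formula for `y_l` holds without restriction on `l`, both sides being `0` outside the index
range. -/
lemma yChain_get (c : Chain (V (B F n))) (l : ℕ) : (yChain c).get l = inclV F n (c.get l) +
    (qInt (Fintype.card F) (l - c.start) : ℂ) • theta F n (c.get (l - 1)) := by
  rw [Chain.get]
  split_ifs with h
  · rfl
  · simp only [yChain] at h
    rcases not_and_or.1 h with h | h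
    · rw [Chain.get_of_lt (by omega), show l - c.start = 0 by omega, qInt_zero]
      simp
    · rw [Chain.get_of_gt (u := l) (by omega), Chain.get_of_gt (u := l - 1) (by omega)]
      simp

lemma zChain_get (hc : IsSymmetricJordanChain dim n c) {u : ℕ} (h : c.start ≤ u)
    (h' : u < c.finish) : (zChain c).get (u + 1) =
      -((Fintype.card F : ℂ) ^ n) • inclV F n (c.get (u + 1)) +
        ((Fintype.card F : ℂ) ^ (u + c.start) * (qInt (Fintype.card F) (c.finish - u) : ℂ)) •
          theta F n (c.get u) := by
  have hn := hc.2
  rw [Chain.get_of_mem (by simp [zChain]; omega) (by simp [zChain]; omega)]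
  simp only [zChain]
  rw [show n - (u + 1) - c.start + 1 = c.finish - u by omega,
    show u + 1 + c.start - 1 = u + c.start by omega, Nat.add_sub_cancel]

lemma yChain_get_comb (c : Chain (V (B F n))) (l : ℕ) : ∃ a b : ℂ,
    (yChain c).get l = a • inclV F n (c.get l) + b • theta F n (c.get (l - 1)) :=
  ⟨1, _, by rw [yChain_get, one_smul]⟩

lemma zChain_get_comb (c : Chain (V (B F n))) (l : ℕ) : ∃ a b : ℂ,
    (zChain c).get l = a • inclV F n (c.get l) + b • theta F n (c.get (l - 1)) := by
  rw [Chain.get]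
  split_ifs
  · exact ⟨_, _, rfl⟩
  · exact ⟨0, 0, by simp⟩

lemma gammaChain_get_succ {m : ℕ} (χ : AddChar (Fin (m + 1) → F) ℂ) (c : Chain (V (B F m)))
    (l : ℕ) : (gammaChain χ c).get (l + 1) = gamma χ (c.get l) := by
  rw [Chain.get]
  split_ifs with h
  · rfl
  · simp only [gammaChain] at h
    rw [Chain.get, if_neg (by omega), map_zero]

lemma gammaChain_get_zero {m : ℕ} (χ : AddChar (Fin (m + 1) → F) ℂ) (c : Chain (V (B F m))) :
    (gammaChain χ c).get 0 = 0 := Chain.get_of_lt (by simp [gammaChain])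

lemma gammaChain_get_eq {m : ℕ} (χ : AddChar (Fin (m + 1) → F) ℂ) (c : Chain (V (B F m)))
    (l : ℕ) : ∃ x, (gammaChain χ c).get l = gamma χ x := by
  cases l with
  | zero => exact ⟨0, by rw [gammaChain_get_zero, map_zero]⟩
  | succ l => exact ⟨_, gammaChain_get_succ χ c l⟩

/-! ### The chains `y` -/

lemma card_pos_real : (0 : ℝ) < Fintype.card F := Nat.cast_pos.2 Fintype.card_pos

lemma yChain_get_start (c : Chain (V (B F n))) :
    (yChain c).get c.start = inclV F n (c.get c.start) := by
  rw [yChain_get, Nat.sub_self, qInt_zero]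
  simp

lemma norm_inclV (x : V (B F n)) : ‖inclV F n x‖ ^ 2 = ‖x‖ ^ 2 := by
  have h := inner_inclV_inclV x x
  simp only [inner_self_eq_norm_sq_to_K] at h
  exact_mod_cast h

/-- The squared norms of the chain `y` in terms of those of `c`, from the identity
`[f-u] + q ^ (f-u) [u+1-k] = [f+1-k]`. The case `u = f` is the last term of `y`. -/
lemma norm_yChain_get_succ (hc : IsSymmetricJordanChain dim n c) (hr : HasNormRatios c) {u : ℕ}
    (h : c.start ≤ u) (h' : u ≤ c.finish) : ‖(yChain c).get (u + 1)‖ ^ 2 =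
      (Fintype.card F : ℝ) ^ c.start * qInt (Fintype.card F) (u + 1 - c.start) *
        qInt (Fintype.card F) (c.finish + 1 - c.start) * ‖c.get u‖ ^ 2 := by
  have hq := card_pos_real (F := F)
  have hn := hc.2
  have h1 := norm_comb (hc.1.homogeneous_get u) (c.get (u + 1)) 1
    (qInt (Fintype.card F) (u + 1 - c.start) : ℂ)
  rw [one_smul] at h1
  have hpow : (Fintype.card F : ℝ) ^ n / (Fintype.card F : ℝ) ^ u =
      (Fintype.card F : ℝ) ^ (c.start + (c.finish - u)) := by
    rw [div_eq_iff (pow_ne_zero _ hq.ne'), ← pow_add]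
    congr 1
    omega
  rw [yChain_get, Nat.add_sub_cancel, h1, hr.le h h', hpow, pow_add,
    show c.finish + 1 - c.start = (c.finish - u) + (u + 1 - c.start) by omega, qInt_add]
  simp only [norm_one, Complex.norm_natCast]
  push_cast
  ring

lemma yChain_hasNormRatios (hc : IsSymmetricJordanChain dim n c) (hr : HasNormRatios c) :
    HasNormRatios (yChain c) := by
  intro l h h'
  change c.start ≤ l at h
  change l < c.finish + 1 at h'
  change _ = (Fintype.card F : ℝ) ^ c.start * qInt (Fintype.card F) (l + 1 - c.start) *
      qInt (Fintype.card F) (c.finish + 1 - l) * _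
  rw [norm_yChain_get_succ hc hr h (by omega)]
  rcases h.lt_or_eq with h | rfl
  · obtain ⟨u, rfl⟩ : ∃ u, l = u + 1 := ⟨l - 1, by omega⟩
    rw [norm_yChain_get_succ hc hr (by omega) (by omega), hr u (by omega) (by omega),
      Nat.add_sub_add_right]
    ring
  · rw [yChain_get_start, norm_inclV]

lemma homogeneous_yChain_get (hc : IsSymmetricJordanChain dim n c) (l : ℕ) :
    IsHomogeneous dim l ((yChain c).get l) := by
  rw [yChain_get]
  refine (hc.1.homogeneous_get l).inclV.add ?_
  cases l with
  | zero => simpa [qInt_zero] using IsHomogeneous.zero _ _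
  | succ l => exact (hc.1.homogeneous_get l).theta.smul _

lemma get_ne_zero (hc : IsSymmetricJordanChain dim n c) {u : ℕ} (h : c.start ≤ u)
    (h' : u ≤ c.finish) : c.get u ≠ 0 := by
  rw [Chain.get_of_mem h h']
  exact hc.1.ne_zero u h h'

lemma isSymmetricJordanChain_yChain (hc : IsSymmetricJordanChain dim n c) (hr : HasNormRatios c) :
    IsSymmetricJordanChain dim (n + 1) (yChain c) := by
  have hn := hc.2
  have hle := hc.1.start_le_finish
  refine ⟨.of_get (by simp only [yChain]; omega) (homogeneous_yChain_get hc) ?_ ?_,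
    by simp only [yChain]; omega⟩
  · intro u h h'
    change c.start ≤ u at h
    change u ≤ c.finish + 1 at h'
    rw [← norm_ne_zero_iff, ← pow_ne_zero_iff two_ne_zero]
    rcases h.lt_or_eq with h | rfl
    · obtain ⟨u, rfl⟩ : ∃ l, u = l + 1 := ⟨u - 1, by omega⟩
      rw [norm_yChain_get_succ hc hr (by omega) (by omega)]
      have h1 := card_pos_real (F := F)
      have h2 := qInt_pos (Fintype.card F) (m := u + 1 - c.start) (by omega)
      have h3 := qInt_pos (Fintype.card F) (m := c.finish + 1 - c.start) (by omega)
      have h4 := norm_pos_iff.2 (get_ne_zero hc (u := u) (by omega) (by omega))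
      positivity
    · rw [yChain_get_start, norm_inclV]
      simpa using get_ne_zero hc le_rfl hle
  · intro u h _
    change c.start ≤ u at h
    rw [yChain_get, yChain_get, map_add, map_smul, up_inclV, up_theta, hc.1.up_get h,
      Nat.add_sub_cancel]
    rcases h.lt_or_eq with h | rfl
    · obtain ⟨u, rfl⟩ : ∃ l, u = l + 1 := ⟨u - 1, by omega⟩
      rw [Nat.add_sub_cancel, hc.1.up_get (by omega),
        show u + 1 + 1 - c.start = 1 + (u + 1 - c.start) by omega, qInt_add, qInt_one]
      push_cast
      module
    · rw [Nat.sub_self, qInt_zero, Nat.add_sub_cancel_left, qInt_one]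
      simp

/-! ### The chains `z` -/

lemma norm_zChain_get_succ (hc : IsSymmetricJordanChain dim n c) (hr : HasNormRatios c) {u : ℕ}
    (h : c.start ≤ u) (h' : u < c.finish) : ‖(zChain c).get (u + 1)‖ ^ 2 =
      (Fintype.card F : ℝ) ^ (n + u + 2 * c.start) * qInt (Fintype.card F) (c.finish - u) *
        qInt (Fintype.card F) (c.finish + 1 - c.start) * ‖c.get u‖ ^ 2 := by
  have hq := card_pos_real (F := F)
  have hn := hc.2
  rw [zChain_get hc h h', norm_comb (hc.1.homogeneous_get u), hr u h h',
    show c.finish + 1 - c.start = (c.finish - u) + (u + 1 - c.start) by omega, qInt_add]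
  simp only [norm_neg, norm_mul, norm_pow, Complex.norm_natCast]
  obtain ⟨e, he⟩ : ∃ e, c.finish - u = e := ⟨_, rfl⟩
  have hpow : (Fintype.card F : ℝ) ^ n = (Fintype.card F : ℝ) ^ (c.start + e + u) := by
    congr 1
    omega
  rw [he, pow_add _ (n + u), pow_add _ n, hpow]
  push_cast
  field_simp
  ring

lemma zChain_hasNormRatios (hc : IsSymmetricJordanChain dim n c) (hr : HasNormRatios c) :
    HasNormRatios (zChain c) := by
  intro l h h'
  change c.start + 1 ≤ l at h
  change l < c.finish at h'
  change _ = (Fintype.card F : ℝ) ^ (c.start + 1) *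
    qInt (Fintype.card F) (l + 1 - (c.start + 1)) * qInt (Fintype.card F) (c.finish - l) * _
  obtain ⟨u, rfl⟩ : ∃ u, l = u + 1 := ⟨l - 1, by omega⟩
  rw [norm_zChain_get_succ hc hr (by omega) h', norm_zChain_get_succ hc hr (by omega) (by omega),
    hr u (by omega) (by omega), Nat.add_sub_add_right]
  ring

lemma homogeneous_zChain_get (hc : IsSymmetricJordanChain dim n c) (l : ℕ) :
    IsHomogeneous dim l ((zChain c).get l) := by
  cases l with
  | zero => rw [Chain.get_of_lt (by simp [zChain])]; exact .zero _ _
  | succ l =>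
    obtain ⟨a, b, h⟩ := zChain_get_comb c (l + 1)
    rw [h]
    exact ((hc.1.homogeneous_get _).inclV.smul a).add ((hc.1.homogeneous_get l).theta.smul b)

lemma isSymmetricJordanChain_zChain (hc : IsSymmetricJordanChain dim n c) (hr : HasNormRatios c)
    (hlt : c.start < c.finish) : IsSymmetricJordanChain dim (n + 1) (zChain c) := by
  have hn := hc.2
  refine ⟨.of_get (by simp only [zChain]; omega) (homogeneous_zChain_get hc) ?_ ?_,
    by simp only [zChain]; omega⟩
  · intro u h h'
    change c.start + 1 ≤ u at h
    change u ≤ c.finish at h'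
    obtain ⟨u, rfl⟩ : ∃ l, u = l + 1 := ⟨u - 1, by omega⟩
    rw [← norm_ne_zero_iff, ← pow_ne_zero_iff two_ne_zero,
      norm_zChain_get_succ hc hr (by omega) (by omega)]
    have h1 := card_pos_real (F := F)
    have h2 := qInt_pos (Fintype.card F) (m := c.finish - u) (by omega)
    have h3 := qInt_pos (Fintype.card F) (m := c.finish + 1 - c.start) (by omega)
    have h4 := norm_pos_iff.2 (get_ne_zero hc (u := u) (by omega) (by omega))
    positivity
  · intro u h h'
    change c.start + 1 ≤ u at h
    change u ≤ c.finish at h'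
    obtain ⟨u, rfl⟩ : ∃ l, u = l + 1 := ⟨u - 1, by omega⟩
    have h1 : up _ ((zChain c).get (u + 1)) =
        -((Fintype.card F : ℂ) ^ n) • inclV F n (c.get (u + 1 + 1)) +
        ((Fintype.card F : ℂ) ^ (u + 1 + c.start) *
          (qInt (Fintype.card F) (c.finish - (u + 1)) : ℂ)) • theta F n (c.get (u + 1)) := by
      rw [zChain_get hc (by omega) (by omega), map_add, map_smul, map_smul, up_inclV, up_theta,
        hc.1.up_get (by omega), hc.1.up_get (by omega)]
      obtain ⟨e, he⟩ : ∃ e, c.finish - (u + 1) = e := ⟨_, rfl⟩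
      have hpow : (Fintype.card F : ℂ) ^ n = (Fintype.card F : ℂ) ^ (u + 1 + c.start + e) := by
        congr 1
        omega
      rw [he, show c.finish - u = e + 1 by omega, qInt_add, qInt_one, hpow]
      push_cast
      module
    rw [h1]
    rcases h'.lt_or_eq with h' | h'
    · rw [zChain_get hc (by omega) h']
    · rw [Chain.get_of_gt (c := zChain c) (by simp only [zChain]; omega),
        Chain.get_of_gt (by omega), h']
      simp [qInt_zero]

/-! ### The chains of a nontrivial character -/

section

variable {m : ℕ} {χ : AddChar (Fin (m + 1) → F) ℂ} {c : Chain (V (B F m))}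

lemma norm_gamma (hχ : χ ≠ 1) {x : V (B F m)} {u : ℕ} (hx : IsHomogeneous dim u x) :
    ‖gamma χ x‖ ^ 2 = (Fintype.card F : ℝ) ^ (m + 1 + u) * ‖x‖ ^ 2 := by
  have h := inner_gamma_gamma hχ hx x
  simp only [inner_self_eq_norm_sq_to_K, Complex.coe_algebraMap] at h
  exact_mod_cast h

lemma gammaChain_hasNormRatios (hχ : χ ≠ 1) (hc : IsSymmetricJordanChain dim m c)
    (hr : HasNormRatios c) : HasNormRatios (gammaChain χ c) := by
  intro l h h'
  change c.start + 1 ≤ l at h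
  change l < c.finish + 1 at h'
  change _ = (Fintype.card F : ℝ) ^ (c.start + 1) *
    qInt (Fintype.card F) (l + 1 - (c.start + 1)) * qInt (Fintype.card F) (c.finish + 1 - l) * _
  obtain ⟨u, rfl⟩ : ∃ u, l = u + 1 := ⟨l - 1, by omega⟩
  rw [gammaChain_get_succ, gammaChain_get_succ, norm_gamma hχ (hc.1.homogeneous_get _),
    norm_gamma hχ (hc.1.homogeneous_get _), hr u (by omega) (by omega), Nat.add_sub_add_right,
    Nat.add_sub_add_right]
  ring

lemma homogeneous_gammaChain_get (hχ : χ ≠ 1) (hc : IsSymmetricJordanChain dim m c) (l : ℕ) :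
    IsHomogeneous dim l ((gammaChain χ c).get l) := by
  cases l with
  | zero => rw [gammaChain_get_zero]; exact .zero _ _
  | succ l => rw [gammaChain_get_succ]; exact (hc.1.homogeneous_get l).gamma hχ

lemma isSymmetricJordanChain_gammaChain (hχ : χ ≠ 1) (hc : IsSymmetricJordanChain dim m c) :
    IsSymmetricJordanChain dim (m + 2) (gammaChain χ c) := by
  have hn := hc.2
  have hle := hc.1.start_le_finish
  refine ⟨.of_get (by simp only [gammaChain]; omega) (homogeneous_gammaChain_get hχ hc) ?_ ?_,
    by simp only [gammaChain]; omega⟩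
  · intro u h h'
    change c.start + 1 ≤ u at h
    change u ≤ c.finish + 1 at h'
    obtain ⟨u, rfl⟩ : ∃ l, u = l + 1 := ⟨u - 1, by omega⟩
    rw [gammaChain_get_succ, ← norm_ne_zero_iff, ← pow_ne_zero_iff two_ne_zero,
      norm_gamma hχ (hc.1.homogeneous_get _)]
    have h1 := card_pos_real (F := F)
    have h4 := norm_pos_iff.2 (get_ne_zero hc (u := u) (by omega) (by omega))
    positivity
  · intro u h h'
    change c.start + 1 ≤ u at h
    obtain ⟨u, rfl⟩ : ∃ l, u = l + 1 := ⟨u - 1, by omega⟩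
    rw [gammaChain_get_succ, gammaChain_get_succ, up_gamma hχ, hc.1.up_get (by omega)]

end

/-! ### Orthogonality of chains -/

/-- All terms of one chain are orthogonal to all terms of the other. -/
def OrthChains {P : Type*} [Fintype P] (c c' : Chain (V P)) : Prop :=
  ∀ u w, inner ℂ (c.get u) (c'.get w) = 0

lemma OrthChains.symm {P : Type*} [Fintype P] {c c' : Chain (V P)} (h : OrthChains c c') :
    OrthChains c' c := fun u w => inner_eq_zero_symm.1 (h w u)

lemma orthChains_of_comb (hc : IsSymmetricJordanChain dim n c) {c' : Chain (V (B F n))}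
    (h : OrthChains c c') {d d' : Chain (V (B F (n + 1)))}
    (hd : ∀ l, ∃ a b : ℂ, d.get l = a • inclV F n (c.get l) + b • theta F n (c.get (l - 1)))
    (hd' : ∀ l, ∃ a b : ℂ,
      d'.get l = a • inclV F n (c'.get l) + b • theta F n (c'.get (l - 1))) :
    OrthChains d d' := by
  intro u w
  obtain ⟨a, b, h1⟩ := hd u
  obtain ⟨a', b', h2⟩ := hd' w
  rw [h1, h2, inner_comb (hc.1.homogeneous_get _), h, h]
  simp

/-- At equal rank `u + 1`, the contributions `-q ^ n ‖x_{u+1}‖ ^ 2` and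
`[u+1-k] q ^ (u+k) [f-u] q ^ (n-u) ‖x_u‖ ^ 2` cancel by the formula for the norm ratios of `c`. -/
lemma orthChains_yChain_zChain (hc : IsSymmetricJordanChain dim n c) (hr : HasNormRatios c) :
    OrthChains (yChain c) (zChain c) := by
  intro l w
  by_cases hlw : l = w
  · subst hlw
    by_cases h : c.start + 1 ≤ l ∧ l ≤ c.finish
    · obtain ⟨u, rfl⟩ : ∃ u, l = u + 1 := ⟨l - 1, by omega⟩
      have h1 := inner_comb (hc.1.homogeneous_get u) (c.get (u + 1)) (c.get (u + 1)) (c.get u)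
        1 (qInt (Fintype.card F) (u + 1 - c.start) : ℂ) (-((Fintype.card F : ℂ) ^ n))
        ((Fintype.card F : ℂ) ^ (u + c.start) * (qInt (Fintype.card F) (c.finish - u) : ℂ))
      rw [one_smul] at h1
      have h2 := hr u (by omega) (by omega)
      rw [yChain_get, zChain_get hc (by omega) (by omega), Nat.add_sub_cancel, h1,
        inner_self_eq_norm_sq_to_K, inner_self_eq_norm_sq_to_K]
      simp only [Complex.coe_algebraMap]
      rw [← Complex.ofReal_pow, h2]
      have hq := card_ne_zero (F := F)
      push_cast
      simp only [map_one, Complex.conj_natCast]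
      field_simp
      ring
    · have h0 : (zChain c).get l = 0 := if_neg h
      rw [h0, inner_zero_right]
  · exact inner_eq_zero_of_homogeneous hlw (homogeneous_yChain_get hc l)
      (homogeneous_zChain_get hc w)

end Chains

/-! ### The induction -/

section Induction

variable {F : Type*} [Field F] [Fintype F] {n : ℕ}

/-- The properties of the collections `J F n` that are carried through the induction. All of them
are phrased through the terms `c.get u`, which vanish outside the index range of `c`. -/
structure IsGoodCollection (J : Set (Chain (V (B F n)))) : Prop where
  chain : ∀ c ∈ J, IsSymmetricJordanChain dim n c
  normRatios : ∀ c ∈ J, HasNormRatios c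
  orth : J.Pairwise OrthChains
  coeff : ∀ c ∈ J, ∀ u X, IsIntMulRoot (Fintype.card F) (c.get u X)
  span : ∀ S : Submodule ℂ (V (B F n)), (∀ c ∈ J, ∀ u, c.get u ∈ S) → S = ⊤

/-- The terms of the chains `y` and `z` of `c` span the images of the terms of `c` under `inclV`
and `theta`. -/
lemma mem_span_yz {c : Chain (V (B F n))} (hc : IsSymmetricJordanChain dim n c)
    (S : Submodule ℂ (V (B F (n + 1)))) (hy : ∀ u, (yChain c).get u ∈ S)
    (hz : c.start < c.finish → ∀ u, (zChain c).get u ∈ S) (u : ℕ) :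
    inclV F n (c.get u) ∈ S ∧ theta F n (c.get u) ∈ S := by
  have hq : 0 < Fintype.card F := Fintype.card_pos
  have key : ∀ u, c.start ≤ u → u ≤ c.finish →
      inclV F n (c.get (u + 1)) ∈ S ∧ theta F n (c.get u) ∈ S := by
    intro u h h'
    have hy' := hy (u + 1)
    rw [yChain_get, Nat.add_sub_cancel] at hy'
    have hpos := qInt_pos (Fintype.card F) (m := u + 1 - c.start) (by omega)
    have htheta : theta F n (c.get u) ∈ S := by
      rcases h'.lt_or_eq with h' | rfl
      -- `q ^ n y + z` is a positive multiple of `theta x_u`, as the terms `inclV x_{u+1}` cancel.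
      · have h1 := S.add_mem (S.smul_mem ((Fintype.card F : ℂ) ^ n) hy')
          (hz (by omega) (u + 1))
        rw [zChain_get hc h h'] at h1
        have h2 : 0 < Fintype.card F ^ n * qInt (Fintype.card F) (u + 1 - c.start) +
            Fintype.card F ^ (u + c.start) * qInt (Fintype.card F) (c.finish - u) := by positivity
        have h3 := Nat.cast_ne_zero (R := ℂ).2 h2.ne'
        rw [← S.smul_mem_iff h3]
        convert h1 using 1
        push_cast
        module
      -- The last term of the chain `y` is a positive multiple of `theta x_u`.
      · rw [Chain.get_of_gt (u := c.finish + 1) (by omega), map_zero, zero_add] at hy'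
        exact (S.smul_mem_iff (Nat.cast_ne_zero.2 hpos.ne')).1 hy'
    exact ⟨(S.add_mem_iff_left (S.smul_mem _ htheta)).1 hy', htheta⟩
  rcases lt_or_ge u c.start with h | h
  · simp [Chain.get_of_lt h]
  rcases lt_or_ge c.finish u with h' | h'
  · simp [Chain.get_of_gt h']
  refine ⟨?_, (key u h h').2⟩
  rcases h.lt_or_eq with h | rfl
  · obtain ⟨u, rfl⟩ : ∃ l, u = l + 1 := ⟨u - 1, by omega⟩
    exact (key u (by omega) (by omega)).1
  · rw [← yChain_get_start]
    exact hy _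

lemma isIntMulRoot_comb {x x' : V (B F n)} (a b : ℤ)
    (hx : ∀ X, IsIntMulRoot (Fintype.card F) (x X))
    (hx' : ∀ X, IsIntMulRoot (Fintype.card F) (x' X)) (Z : B F (n + 1)) :
    IsIntMulRoot (Fintype.card F) (((a : ℂ) • inclV F n x + (b : ℂ) • theta F n x') Z) := by
  rw [PiLp.add_apply, PiLp.smul_apply, PiLp.smul_apply, inclV_apply, theta_apply]
  split_ifs
  · simpa using (hx' _).intCast_mul b
  · simpa using (hx _).intCast_mul a

lemma isIntMulRoot_yChain {c : Chain (V (B F n))}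
    (h : ∀ u X, IsIntMulRoot (Fintype.card F) (c.get u X)) (u : ℕ) (Z : B F (n + 1)) :
    IsIntMulRoot (Fintype.card F) ((yChain c).get u Z) := by
  rw [yChain_get]
  simpa using isIntMulRoot_comb 1 (qInt (Fintype.card F) (u - c.start)) (h u) (h (u - 1)) Z

lemma isIntMulRoot_zChain {c : Chain (V (B F n))}
    (h : ∀ u X, IsIntMulRoot (Fintype.card F) (c.get u X)) (u : ℕ) (Z : B F (n + 1)) :
    IsIntMulRoot (Fintype.card F) ((zChain c).get u Z) := by
  rw [Chain.get]
  split_ifs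
  · simpa [zChain] using isIntMulRoot_comb (-(Fintype.card F) ^ n)
      ((Fintype.card F) ^ (u + c.start - 1) * qInt (Fintype.card F) (n - u - c.start + 1))
      (h u) (h (u - 1)) Z
  · exact .zero _

lemma isIntMulRoot_gammaChain {m : ℕ} {χ : AddChar (Fin (m + 1) → F) ℂ} (hχ : χ ≠ 1)
    {c : Chain (V (B F m))} (h : ∀ u X, IsIntMulRoot (Fintype.card F) (c.get u X)) (u : ℕ)
    (Z : B F (m + 2)) : IsIntMulRoot (Fintype.card F) ((gammaChain χ c).get u Z) := by
  cases u with
  | zero => rw [gammaChain_get_zero]; exact .zero _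
  | succ u =>
    rw [gammaChain_get_succ, gamma_eq_spread hχ, spread_apply]
    exact (isIntMulRoot_affSum χ Z).mul (h u _)

lemma orthChains_gammaChain {m : ℕ} {χ χ' : AddChar (Fin (m + 1) → F) ℂ} (hχ : χ ≠ 1)
    (hχ' : χ' ≠ 1) {c c' : Chain (V (B F m))} (hc : IsSymmetricJordanChain dim m c)
    (h : χ = χ' → OrthChains c c') : OrthChains (gammaChain χ c) (gammaChain χ' c') := by
  intro u w
  by_cases hχχ : χ = χ'
  · subst hχχ
    cases u with
    | zero => rw [gammaChain_get_zero, inner_zero_left]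
    | succ u =>
      cases w with
      | zero => rw [gammaChain_get_zero, inner_zero_right]
      | succ w =>
        rw [gammaChain_get_succ, gammaChain_get_succ, inner_gamma_gamma hχ (hc.1.homogeneous_get _),
          h rfl, mul_zero]
  · obtain ⟨x, hx⟩ := gammaChain_get_eq χ c u
    obtain ⟨x', hx'⟩ := gammaChain_get_eq χ' c' w
    rw [hx, hx', gamma_eq_spread hχ, gamma_eq_spread hχ', inner_spread, if_neg hχχ]

lemma orthChains_comb_gammaChain {m : ℕ} {χ : AddChar (Fin (m + 1) → F) ℂ} (hχ : χ ≠ 1)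
    {c : Chain (V (B F (m + 1)))} {c' : Chain (V (B F m))} {d : Chain (V (B F (m + 2)))}
    (hd : ∀ l, ∃ a b : ℂ,
      d.get l = a • inclV F (m + 1) (c.get l) + b • theta F (m + 1) (c.get (l - 1))) :
    OrthChains d (gammaChain χ c') := by
  intro u w
  obtain ⟨a, b, h⟩ := hd u
  obtain ⟨x, hx⟩ := gammaChain_get_eq χ c' w
  rw [h, hx, inner_comb_gamma hχ]

lemma mem_J_succ_succ {m : ℕ} {d : Chain (V (B F (m + 2)))} : d ∈ J F (m + 2) ↔
    (∃ c ∈ J F (m + 1), yChain c = d) ∨ (∃ c ∈ J F (m + 1), c.start < c.finish ∧ zChain c = d) ∨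
      ∃ χ : AddChar (Fin (m + 1) → F) ℂ, χ ≠ 1 ∧ ∃ c ∈ J F m, gammaChain χ c = d := by
  simp [J, or_assoc, and_assoc]

lemma IsGoodCollection.succ_succ {m : ℕ} (h0 : IsGoodCollection (J F m))
    (h1 : IsGoodCollection (J F (m + 1))) : IsGoodCollection (J F (m + 2)) where
  chain d hd := by
    rcases mem_J_succ_succ.1 hd with ⟨c, hc, rfl⟩ | ⟨c, hc, hlt, rfl⟩ | ⟨χ, hχ, c, hc, rfl⟩
    · exact isSymmetricJordanChain_yChain (h1.chain c hc) (h1.normRatios c hc)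
    · exact isSymmetricJordanChain_zChain (h1.chain c hc) (h1.normRatios c hc) hlt
    · exact isSymmetricJordanChain_gammaChain hχ (h0.chain c hc)
  normRatios d hd := by
    rcases mem_J_succ_succ.1 hd with ⟨c, hc, rfl⟩ | ⟨c, hc, hlt, rfl⟩ | ⟨χ, hχ, c, hc, rfl⟩
    · exact yChain_hasNormRatios (h1.chain c hc) (h1.normRatios c hc)
    · exact zChain_hasNormRatios (h1.chain c hc) (h1.normRatios c hc)
    · exact gammaChain_hasNormRatios hχ (h0.chain c hc) (h0.normRatios c hc)
  orth d hd d' hd' hne := by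
    have hyz : ∀ c ∈ J F (m + 1), ∀ c' ∈ J F (m + 1), OrthChains (yChain c) (zChain c') := by
      intro c hc c' hc'
      by_cases h : c = c'
      · subst h
        exact orthChains_yChain_zChain (h1.chain c hc) (h1.normRatios c hc)
      · exact orthChains_of_comb (h1.chain c hc) (h1.orth hc hc' h) (yChain_get_comb c)
          (zChain_get_comb c')
    rcases mem_J_succ_succ.1 hd with ⟨c, hc, rfl⟩ | ⟨c, hc, hlt, rfl⟩ | ⟨χ, hχ, c, hc, rfl⟩ <;>
    rcases mem_J_succ_succ.1 hd' with ⟨c', hc', rfl⟩ | ⟨c', hc', -, rfl⟩ | ⟨χ', hχ', c', hc', rfl⟩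
    · exact orthChains_of_comb (h1.chain c hc) (h1.orth hc hc' fun h => hne (h ▸ rfl))
        (yChain_get_comb c) (yChain_get_comb c')
    · exact hyz c hc c' hc'
    · exact orthChains_comb_gammaChain hχ' (yChain_get_comb c)
    · exact (hyz c' hc' c hc).symm
    · exact orthChains_of_comb (h1.chain c hc) (h1.orth hc hc' fun h => hne (h ▸ rfl))
        (zChain_get_comb c) (zChain_get_comb c')
    · exact orthChains_comb_gammaChain hχ' (zChain_get_comb c)
    · exact (orthChains_comb_gammaChain hχ (yChain_get_comb c')).symm
    · exact (orthChains_comb_gammaChain hχ (zChain_get_comb c')).symm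
    · refine orthChains_gammaChain hχ hχ' (h0.chain c hc) ?_
      rintro rfl
      exact h0.orth hc hc' fun h => hne (h ▸ rfl)
  coeff d hd := by
    rcases mem_J_succ_succ.1 hd with ⟨c, hc, rfl⟩ | ⟨c, hc, -, rfl⟩ | ⟨χ, hχ, c, hc, rfl⟩
    · exact isIntMulRoot_yChain (h1.coeff c hc)
    · exact isIntMulRoot_zChain (h1.coeff c hc)
    · exact isIntMulRoot_gammaChain hχ (h0.coeff c hc)
  span S hS := by
    have hyz : ∀ c ∈ J F (m + 1), ∀ u,
        inclV F (m + 1) (c.get u) ∈ S ∧ theta F (m + 1) (c.get u) ∈ S := fun c hc =>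
      mem_span_yz (h1.chain c hc) S
        (fun u => hS _ (mem_J_succ_succ.2 (Or.inl ⟨c, hc, rfl⟩)) u)
        (fun hlt u => hS _ (mem_J_succ_succ.2 (Or.inr (Or.inl ⟨c, hc, hlt, rfl⟩))) u)
    refine span_images_eq_top S (fun x => ?_) (fun x => ?_) fun χ hχ x => ?_
    · have h := h1.span (S.comap (inclV F (m + 1))) fun c hc u => (hyz c hc u).1
      exact h.ge (Submodule.mem_top (x := x))
    · have h := h1.span (S.comap (theta F (m + 1))) fun c hc u => (hyz c hc u).2
      exact h.ge (Submodule.mem_top (x := x))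
    · have h := h0.span (S.comap (gamma χ)) fun c hc u => by
        have := hS _ (mem_J_succ_succ.2 (Or.inr (Or.inr ⟨χ, hχ, c, hc, rfl⟩))) (u + 1)
        rwa [gammaChain_get_succ] at this
      exact h.ge (Submodule.mem_top (x := x))

lemma isHomogeneous_basisVec {X : B F n} {i : ℕ} (hX : dim X = i) :
    IsHomogeneous dim i (basisVec X) := by
  intro Y hY
  rw [basisVec_apply] at hY
  split_ifs at hY with h
  · rw [h, hX]
  · exact absurd rfl hY

lemma isIntMulRoot_basisVec (q : ℕ) (X Y : B F n) : IsIntMulRoot q (basisVec X Y) := by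
  rw [basisVec_apply]
  split_ifs
  · exact ⟨1, 1, by simp, by simp⟩
  · exact .zero q

lemma basisVec_ne_zero (X : B F n) : (basisVec X : V (B F n)) ≠ 0 := by
  intro h
  have := congrArg (fun v : V (B F n) => v X) h
  simp [basisVec_apply] at this

lemma norm_basisVec (X : B F n) : ‖(basisVec X : V (B F n))‖ = 1 :=
  (EuclideanSpace.basisFun _ ℂ).orthonormal.1 X

lemma up_basisVec_top : up (B F n) (basisVec ⊤) = 0 := by
  ext Y
  rw [up_apply]
  refine Finset.sum_eq_zero fun X hX => ?_
  rw [basisVec_apply, if_neg]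
  rintro rfl
  exact not_top_lt (Finset.mem_filter.1 hX).2.lt

lemma isGoodCollection_zero : IsGoodCollection (J F 0) := by
  have hget : ∀ u, (⟨0, 0, fun _ => basisVec ⊥⟩ : Chain (V (B F 0))).get u =
      if u = 0 then basisVec ⊥ else 0 := fun u => by simp [Chain.get]
  have hJ : J F 0 = {⟨0, 0, fun _ => basisVec ⊥⟩} := rfl
  have hbot : dim (⊥ : B F 0) = 0 := finrank_bot F _
  rw [hJ]
  refine ⟨?_, ?_, Set.pairwise_singleton _ _, ?_, ?_⟩
  · rintro c rfl
    refine ⟨.of_get le_rfl (fun u => ?_) (fun u _ _ => ?_) fun u _ hu => ?_, rfl⟩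
    · rw [hget]
      split_ifs with h
      · rw [h]
        exact isHomogeneous_basisVec hbot
      · exact .zero _ _
    · rw [hget, if_pos (by simp_all)]
      exact basisVec_ne_zero _
    · rw [hget, hget, if_pos (by simp_all), if_neg (by omega), Subsingleton.elim (⊥ : B F 0) ⊤,
        up_basisVec_top]
  · rintro c rfl u _ hu
    exact absurd hu (Nat.not_lt_zero _)
  · rintro c rfl u X
    rw [hget]
    split_ifs
    · exact isIntMulRoot_basisVec _ _ _
    · exact .zero _
  · intro S hS
    rw [← top_le_iff, ← span_basisVec, Submodule.span_le]
    rintro _ ⟨X, rfl⟩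
    have := hS _ rfl 0
    rw [hget, if_pos rfl] at this
    rwa [Subsingleton.elim X ⊥]

lemma up_basisVec_bot : up (B F 1) (basisVec ⊥) = basisVec ⊤ := by
  ext Y
  rw [up, linExt_basisVec, sum_basisVec_apply, basisVec_apply]
  have h : (⊥ : B F 1) ⋖ ⊤ :=
    ⟨bot_lt_top, fun X h h' => (eq_bot_or_eq_top X).elim h.ne' h'.ne⟩
  rcases eq_bot_or_eq_top Y with rfl | rfl
  · rw [if_neg fun h' => (Finset.mem_filter.1 h').2.lt.ne rfl, if_neg h.lt.ne]
  · simp only [Finset.mem_filter, h, Finset.mem_univ, true_and, if_true]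

lemma isGoodCollection_one : IsGoodCollection (J F 1) := by
  have hget : ∀ u, (⟨0, 1, fun u => if u = 0 then basisVec ⊥ else basisVec ⊤⟩ :
      Chain (V (B F 1))).get u =
        if u = 0 then basisVec ⊥ else if u = 1 then basisVec ⊤ else 0 := fun u => by
    rw [Chain.get]
    rcases u with _ | _ | u <;> simp
  have hJ : J F 1 = {⟨0, 1, fun u => if u = 0 then basisVec ⊥ else basisVec ⊤⟩} := rfl
  have hbot : dim (⊥ : B F 1) = 0 := finrank_bot F _
  have htop : dim (⊤ : B F 1) = 1 := by rw [dim, finrank_top]; simp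
  rw [hJ]
  refine ⟨?_, ?_, Set.pairwise_singleton _ _, ?_, ?_⟩
  · rintro c rfl
    refine ⟨.of_get (by simp) (fun u => ?_) (fun u _ hu => ?_) fun u _ hu => ?_, rfl⟩
    · rw [hget]
      split_ifs with h h'
      · rw [h]
        exact isHomogeneous_basisVec hbot
      · rw [h']
        exact isHomogeneous_basisVec htop
      · exact .zero _ _
    · rw [hget]
      rcases Nat.le_one_iff_eq_zero_or_eq_one.1 hu with rfl | rfl
      · simpa using basisVec_ne_zero _
      · simpa using basisVec_ne_zero _
    · rw [hget, hget]
      rcases Nat.le_one_iff_eq_zero_or_eq_one.1 hu with rfl | rfl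
      · simpa using up_basisVec_bot
      · simpa using up_basisVec_top
  · rintro c rfl u _ hu
    obtain rfl : u = 0 := by simpa using hu
    rw [hget, hget]
    simp [norm_basisVec, qInt_one]
  · rintro c rfl u X
    rw [hget]
    split_ifs
    · exact isIntMulRoot_basisVec _ _ _
    · exact isIntMulRoot_basisVec _ _ _
    · exact .zero _
  · intro S hS
    rw [← top_le_iff, ← span_basisVec, Submodule.span_le]
    rintro _ ⟨X, rfl⟩
    have h0 := hS _ rfl 0
    have h1 := hS _ rfl 1
    rw [hget] at h0 h1
    rcases eq_bot_or_eq_top X with rfl | rfl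
    · simpa using h0
    · simpa using h1

variable (F) in
lemma isGoodCollection (n : ℕ) : IsGoodCollection (J F n) := by
  induction n using Nat.twoStepInduction with
  | zero => exact isGoodCollection_zero
  | one => exact isGoodCollection_one
  | more n h0 h1 => exact h0.succ_succ h1

lemma mem_allVectors {J : Set (Chain (V (B F n)))} {v : V (B F n)} : v ∈ allVectors J ↔
    ∃ c ∈ J, ∃ u, c.start ≤ u ∧ u ≤ c.finish ∧ c.get u = v := by
  simp only [allVectors, Chain.vectors, Set.mem_iUnion, Set.mem_image, Set.mem_Icc, exists_prop]
  refine exists_congr fun c => and_congr_right fun _ => exists_congr fun u => ?_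
  rw [and_assoc]
  refine and_congr_right fun h => and_congr_right fun h' => ?_
  rw [Chain.get_of_mem h h']

lemma IsGoodCollection.isOrthogonalFamily {J : Set (Chain (V (B F n)))}
    (h : IsGoodCollection J) : IsOrthogonalFamily J := by
  intro v hv w hw hne
  obtain ⟨c, hc, u, -, -, rfl⟩ := mem_allVectors.1 hv
  obtain ⟨c', hc', u', -, -, rfl⟩ := mem_allVectors.1 hw
  by_cases hcc : c = c'
  · subst hcc
    exact inner_eq_zero_of_homogeneous (fun huu => hne (congrArg c.get huu))
      ((h.chain c hc).1.homogeneous_get u) ((h.chain c hc).1.homogeneous_get u')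
  · exact h.orth hc hc' hcc u u'

lemma IsGoodCollection.isSymmetricJordanBasis {J : Set (Chain (V (B F n)))}
    (h : IsGoodCollection J) : IsSymmetricJordanBasis dim n J where
  chain := h.chain
  disjoint c hc c' hc' hne := by
    refine Set.disjoint_left.2 ?_
    rintro _ ⟨u, ⟨hu1, hu2⟩, rfl⟩ ⟨w, ⟨hw1, hw2⟩, hw⟩
    have h0 := h.orth hc hc' hne u w
    rw [Chain.get_of_mem hu1 hu2, Chain.get_of_mem hw1 hw2, hw, inner_self_eq_zero] at h0
    exact (h.chain c hc).1.ne_zero u hu1 hu2 h0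
  linearIndep := by
    refine linearIndependent_of_ne_zero_of_inner_eq_zero (𝕜 := ℂ) ?_ ?_
    · rintro ⟨v, hv⟩
      obtain ⟨c, hc, u, hu, hu', rfl⟩ := mem_allVectors.1 hv
      exact get_ne_zero (h.chain c hc) hu hu'
    · intro v w hvw
      exact h.isOrthogonalFamily v.2 w.2 fun h => hvw (Subtype.ext h)
  span_eq_top := by
    refine h.span _ fun c hc u => ?_
    by_cases hu : c.start ≤ u ∧ u ≤ c.finish
    · exact Submodule.subset_span (mem_allVectors.2 ⟨c, hc, u, hu.1, hu.2, rfl⟩)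
    · rw [show c.get u = 0 from if_neg hu]
      exact Submodule.zero_mem _

end Induction

end

end SubspaceLattice

theorem theorem2 (F : Type*) [Field F] [Fintype F] (n : ℕ) :
    SubspaceLattice.IsSymmetricJordanBasis SubspaceLattice.dim n (SubspaceLattice.J F n) ∧
    SubspaceLattice.IsOrthogonalFamily (SubspaceLattice.J F n) ∧
    (∀ v ∈ SubspaceLattice.allVectors (SubspaceLattice.J F n), ∀ X : SubspaceLattice.B F n,
      ∃ (m : ℤ) (ζ : ℂ), ζ ^ Fintype.card F = 1 ∧ v X = m * ζ) ∧
    (Fintype.card F = 2 →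
      ∀ v ∈ SubspaceLattice.allVectors (SubspaceLattice.J F n), ∀ X : SubspaceLattice.B F n,
        ∃ m : ℤ, v X = m) ∧
    (∀ k : ℕ, 2 * k ≤ n → ∀ c ∈ SubspaceLattice.J F n, c.start = k → c.finish = n - k →
      ∀ u : ℕ, k ≤ u → u < n - k →
        ‖c.vec (u + 1)‖ / ‖c.vec u‖ =
          √((Fintype.card F : ℝ) ^ k * (SubspaceLattice.qInt (Fintype.card F) (u + 1 - k) : ℝ) *
            (SubspaceLattice.qInt (Fintype.card F) (n - k - u) : ℝ))) := by
  have h := SubspaceLattice.isGoodCollection F n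
  have hcoeff : ∀ v ∈ SubspaceLattice.allVectors (SubspaceLattice.J F n),
      ∀ X : SubspaceLattice.B F n, SubspaceLattice.IsIntMulRoot (Fintype.card F) (v X) := by
    intro v hv X
    obtain ⟨c, hc, u, -, -, rfl⟩ := SubspaceLattice.mem_allVectors.1 hv
    exact h.coeff c hc u X
  refine ⟨h.isSymmetricJordanBasis, h.isOrthogonalFamily, hcoeff, fun h2 v hv X => ?_, ?_⟩
  · obtain ⟨m, ζ, hζ, hvX⟩ := hcoeff v hv X
    rw [h2, sq_eq_one_iff] at hζ
    rcases hζ with rfl | rfl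
    · exact ⟨m, by simpa using hvX⟩
    · exact ⟨-m, by simpa using hvX⟩
  · rintro _ - c hc rfl hfin u hu hu'
    rw [← hfin] at hu' ⊢
    rw [← SubspaceLattice.Chain.get_of_mem hu hu'.le,
      ← SubspaceLattice.Chain.get_of_mem (Nat.le_succ_of_le hu) hu']
    have hpos := norm_pos_iff.2 (SubspaceLattice.get_ne_zero (h.chain c hc) hu hu'.le)
    rw [eq_comm, Real.sqrt_eq_iff_mul_self_eq (by positivity) (by positivity), ← sq, div_pow,
      h.normRatios c hc u hu hu', mul_div_cancel_right₀ _ (pow_ne_zero 2 hpos.ne')]
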